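/- Let $G=(V,E)$ be a finite, nonempty, simple undirected graph (the current graph at step $t$). For $v\in V$ let $N(v)$ be the set consisting of $v$ and all its neighbours, and $d(v)=|N(v)|$. A clustering of $G$ is a partition of $V$ into nonempty clusters; its cost is the number of edges between different clusters plus the number of unordered pairs of distinct non-adjacent vertices in the same cluster; an optimal clustering is one of minimum cost, and $\mathrm{opt}(G)$ is that minimum. A cluster $C$ is $\eta$-good-on-average if $\sum_{u\in C}|N(u)\triangle C|\le \eta|C|^2$. A pivot step picks $u\in V$ uniformly at random, creates the cluster $C=N(u)$, and removes $C$ together with all incident edges from $G$. Let $\mathrm{ALG}_t$ be the number of edges between $C$ and $V\setminus C$ plus the number of unordered pairs of distinct non-adjacent vertices in $C$, and let $\mathrm{OPT}_t=\mathrm{opt}(G)-\mathrm{opt}(G[V\setminus C])$. Let $\varepsilon$ be a real number and let $\mathcal C^*$ be an optimal clustering of $G$. If no cluster of $\mathcal C^*$ is $\varepsilon^2$-good-on-average, then $$\mathbb E[\mathrm{ALG}_t]\le\left(3-\frac{\varepsilon^2}{\frac56\varepsilon^2+1}\right)\mathbb E[\mathrm{OPT}_t].$$ Moreover, a pivot step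 can be carried out in time $O\bigl(\sum_{v\in C}d(v)\bigr)$, where $d$ refers to the graph before the removal and the implied constant is absolute. Precisely: there is a program for a random access machine (unit-cost instructions: assignment, increment, decrement, array access, jump on equality, uniform random choice from $\{0,\dots,k-1\}$) which, started with any such $G$ stored by adjacency arrays with cross pointers between the two entries of each edge and an indexed array of the vertices present, outputs a cluster $C$ distributed as in a pivot step, leaves $G[V\setminus C]$ stored in the same way, and for every outcome of the random choices executes at most $K\sum_{v\in C}d(v)$ instructions, with $K$ an absolute constant. -/

import Mathlib

open scoped symmDiff

/-! ### Correlation clustering -/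

namespace CorrClust

section Graph

variable {V : Type*} [Fintype V] [DecidableEq V]

open Classical in
/-- The closed neighbourhood `N(v)`, which contains `v` itself. -/
noncomputable def nbhd (G : SimpleGraph V) (v : V) : Finset V :=
  Finset.univ.filter fun w => w = v ∨ G.Adj v w

/-- `d(v) = |N(v)|`, i.e. the degree plus one. -/
noncomputable def deg (G : SimpleGraph V) (v : V) : ℕ :=
  (nbhd G v).card

/-- A clustering is a partition of the vertex set into nonempty clusters. -/
abbrev Clustering (V : Type*) [Fintype V] [DecidableEq V] : Type _ :=
  Finpartition (Finset.univ : Finset V)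

/-- The cost of a clustering: edges not contained in a cluster, plus unordered pairs of
distinct nonadjacent vertices contained in a cluster. -/
noncomputable def cost (G : SimpleGraph V) (P : Clustering V) : ℕ :=
  {e : Sym2 V | e ∈ G.edgeSet ∧ ¬ ∃ C ∈ P.parts, ∀ v ∈ e, v ∈ C}.ncard +
  {e : Sym2 V | e ∈ Gᶜ.edgeSet ∧ ∃ C ∈ P.parts, ∀ v ∈ e, v ∈ C}.ncard

/-- A clustering of minimum cost. -/
def IsOptimal (G : SimpleGraph V) (P : Clustering V) : Prop :=
  ∀ Q : Clustering V, cost G P ≤ cost G Q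

/-- The minimum cost of a clustering of `G`. -/
noncomputable def optCost (G : SimpleGraph V) : ℕ :=
  sInf (Set.range (cost G))

/-- `C` is `η`-good-on-average if `∑_{u ∈ C} |N(u) △ C| ≤ η |C|²`. -/
def GoodOnAverage (G : SimpleGraph V) (η : ℝ) (C : Finset V) : Prop :=
  ((∑ u ∈ C, (nbhd G u ∆ C).card : ℕ) : ℝ) ≤ η * (C.card : ℝ) ^ 2

/-- The graph that remains when the cluster `C` and all edges incident to it are removed. -/
abbrev remaining (G : SimpleGraph V) (C : Finset V) : SimpleGraph {v : V // v ∉ C} :=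
  G.comap Subtype.val

/-- The number of constraints violated by removing `C` as a cluster: edges leaving `C`, plus
unordered pairs of distinct nonadjacent vertices inside `C`. -/
noncomputable def stepCost (G : SimpleGraph V) (C : Finset V) : ℕ :=
  {e : Sym2 V | e ∈ G.edgeSet ∧ (∃ v ∈ e, v ∈ C) ∧ ∃ v ∈ e, v ∉ C}.ncard +
  {e : Sym2 V | e ∈ Gᶜ.edgeSet ∧ ∀ v ∈ e, v ∈ C}.ncard

/-- The decrease of the cost of the optimal solution when `C` is removed. -/
noncomputable def optDecrease (G : SimpleGraph V) (C : Finset V) : ℝ :=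
  (optCost G : ℝ) - (optCost (remaining G C) : ℝ)

/-- The law of the cluster created by a pivot step: `C = N(u)` for a uniformly random `u`. -/
noncomputable def pivotStep [Nonempty V] (G : SimpleGraph V) : PMF (Finset V) :=
  (PMF.uniformOfFintype V).map (nbhd G)

/-- The expectation of `f` under a probability mass function on a finite type. -/
noncomputable def expect {α : Type*} [Fintype α] (p : PMF α) (f : α → ℝ) : ℝ :=
  ∑ a, (p a).toReal * f a

end Graph

/-! ### A randomized random access machine

The machine has registers and arrays whose cells hold natural numbers; a program is finite and
thus refers to finitely many registers and arrays.
Each instruction takes one unit of time. The only arithmetic is the addition or subtraction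
of one, so `t` steps increase the largest stored number by at most `t` (beyond the constants
of the program and the numbers that were stored at the start). -/

/-- Contents of the registers and arrays. -/
structure Memory where
  reg : ℕ → ℕ
  arr : ℕ → ℕ → ℕ

/-- The instructions. Register and array numbers are constants of the program. -/
inductive Instr where
  /-- `reg r := k` -/
  | const (r k : ℕ)
  /-- `reg r := reg s` -/
  | copy (r s : ℕ)
  /-- `reg r := reg r + 1` -/
  | inc (r : ℕ)
  /-- `reg r := reg r - 1`, where `0 - 1 = 0` -/
  | dec (r : ℕ)
  /-- `reg r := arr a [reg s]` -/
  | load (r a s : ℕ)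
  /-- `arr a [reg s] := reg r` -/
  | store (a s r : ℕ)
  /-- go to instruction `l` if `reg r = reg s` -/
  | jumpEq (r s l : ℕ)
  /-- `reg r :=` a fresh uniformly random element of `{0, …, reg s - 1}` -/
  | rand (r s : ℕ)

/-- A program is a finite list of instructions; the machine halts when the program counter
leaves the list. -/
abbrev Program : Type := List Instr

/-- Memory, program counter, and the number of instructions executed so far. -/
structure Config where
  mem : Memory
  pc : ℕ
  time : ℕ

def Memory.setReg (M : Memory) (r x : ℕ) : Memory :=
  { M with reg := Function.update M.reg r x }

def Memory.setArr (M : Memory) (a i x : ℕ) : Memory :=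
  { M with arr := Function.update M.arr a (Function.update (M.arr a) i x) }

/-- The uniform law on `{0, …, n - 1}` (the point mass at `0` if `n = 0`). -/
noncomputable def drawBelow (n : ℕ) : PMF ℕ :=
  if h : (Finset.range n).Nonempty then PMF.uniformOfFinset (Finset.range n) h else PMF.pure 0

/-- Continue with the next instruction and memory `M`. -/
def Config.next (c : Config) (M : Memory) : Config :=
  ⟨M, c.pc + 1, c.time + 1⟩

/-- The law of the configuration after executing instruction `i`. -/
noncomputable def exec (c : Config) : Instr → PMF Config
  | .const r k => PMF.pure (c.next (c.mem.setReg r k))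
  | .copy r s => PMF.pure (c.next (c.mem.setReg r (c.mem.reg s)))
  | .inc r => PMF.pure (c.next (c.mem.setReg r (c.mem.reg r + 1)))
  | .dec r => PMF.pure (c.next (c.mem.setReg r (c.mem.reg r - 1)))
  | .load r a s => PMF.pure (c.next (c.mem.setReg r (c.mem.arr a (c.mem.reg s))))
  | .store a s r => PMF.pure (c.next (c.mem.setArr a (c.mem.reg s) (c.mem.reg r)))
  | .jumpEq r s l =>
      PMF.pure ⟨c.mem, if c.mem.reg r = c.mem.reg s then l else c.pc + 1, c.time + 1⟩
  | .rand r s => (drawBelow (c.mem.reg s)).map fun x => c.next (c.mem.setReg r x)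

/-- The machine has halted. -/
def Halted (P : Program) (c : Config) : Prop :=
  P.length ≤ c.pc

/-- One step of the machine; a halted configuration does not change any more. -/
noncomputable def step (P : Program) (c : Config) : PMF Config :=
  match P[c.pc]? with
  | some i => exec c i
  | none => PMF.pure c

/-- The law of the configuration after (at most) `N` steps from memory `M`. -/
noncomputable def run (P : Program) (M : Memory) : ℕ → PMF Config
  | 0 => PMF.pure ⟨M, 0, 0⟩
  | N + 1 => (run P M N).bind (step P)

/-! ### The stored graph

Vertices are named by natural numbers. The graph is stored by adjacency arrays with cross
pointers: the entries of the adjacency array of a vertex occupy an interval of slots, and each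
slot also holds the address of the slot of the same edge at its other endpoint. The vertices
that are present are listed in an array, together with their positions in it. -/

namespace Memory

/-- The number of vertices that are present. -/
abbrev size (M : Memory) : ℕ := M.reg 0
/-- The number of vertices in the output. -/
abbrev outSize (M : Memory) : ℕ := M.reg 1
/-- The `i`-th vertex that is present. -/
abbrev vert (M : Memory) (i : ℕ) : ℕ := M.arr 0 i
/-- The position of a vertex in the array of the vertices that are present. -/
abbrev pos (M : Memory) (x : ℕ) : ℕ := M.arr 1 x
/-- The first slot of the adjacency array of a vertex. -/
abbrev first (M : Memory) (x : ℕ) : ℕ := M.arr 2 x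
/-- The slot just after the adjacency array of a vertex. -/
abbrev last (M : Memory) (x : ℕ) : ℕ := M.arr 3 x
/-- The neighbour stored in a slot. -/
abbrev target (M : Memory) (s : ℕ) : ℕ := M.arr 4 s
/-- The slot of the same edge at the other endpoint. -/
abbrev cross (M : Memory) (s : ℕ) : ℕ := M.arr 5 s
/-- The `i`-th vertex of the output. -/
abbrev out (M : Memory) (i : ℕ) : ℕ := M.arr 6 i

/-- The slots of the adjacency array of the vertex named `x`. -/
def slots (M : Memory) (x : ℕ) : Set ℕ := Set.Ico (M.first x) (M.last x)

end Memory

/-- The memory `M` stores the graph `G`, whose vertices have the given names. -/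
structure Stores {V : Type*} [Fintype V] (M : Memory) (name : V → ℕ) (G : SimpleGraph V) :
    Prop where
  name_injective : Function.Injective name
  size_eq : M.size = Fintype.card V
  vert_mem : ∀ i < M.size, ∃ v, M.vert i = name v
  pos_spec : ∀ v, M.pos (name v) < M.size ∧ M.vert (M.pos (name v)) = name v
  first_le_last : ∀ v, M.first (name v) ≤ M.last (name v)
  disjoint : ∀ v w, v ≠ w → Disjoint (M.slots (name v)) (M.slots (name w))
  target_injOn : ∀ v, Set.InjOn M.target (M.slots (name v))
  target_image : ∀ v, M.target '' M.slots (name v) = name '' G.neighborSet v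
  cross_spec : ∀ v w, ∀ s ∈ M.slots (name v), M.target s = name w →
    M.cross s ∈ M.slots (name w) ∧ M.target (M.cross s) = name v

section Output

variable {V : Type*} [Fintype V] [DecidableEq V]

open Classical in
/-- The set of the vertices listed in the output. -/
noncomputable def outCluster (name : V → ℕ) (M : Memory) : Finset V :=
  Finset.univ.filter fun v => ∃ i < M.outSize, M.out i = name v

/-- The program `P` performs a pivot step on `G` in time at most `K · ∑_{v ∈ C} d(v)`: started
in any memory that stores `G` (all other registers and cells being arbitrary), it halts for all
random choices; the cluster `C` that it outputs (without repetitions) has the law of a pivot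
step; the number of executed instructions is at most `K · ∑_{v ∈ C} d(v)`, for every outcome;
and afterwards the memory stores, under the same names, the graph from which `C` has been
removed. -/
def PerformsPivotStep [Nonempty V] (P : Program) (K : ℕ) (G : SimpleGraph V) : Prop :=
  ∀ (name : V → ℕ) (M : Memory), Stores M name G →
    ∃ N : ℕ,
      (run P M N).map (fun c => outCluster name c.mem) = pivotStep G ∧
      ∀ c ∈ (run P M N).support,
        Halted P c ∧
        (outCluster name c.mem).card = c.mem.outSize ∧
        c.time ≤ K * ∑ v ∈ outCluster name c.mem, deg G v ∧
        Stores c.mem (fun v : {v : V // v ∉ outCluster name c.mem} => name v)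
          (remaining G (outCluster name c.mem))

end Output

end CorrClust

/-!
Sum over all pivots `u`. A pair is violated by the step exactly for the pivots that complete it to a
bad triangle (a triple with exactly two edges), and clustering the remaining graph as the optimum
does, with the cluster of `u` broken into singletons, bounds the decrease of the optimum from below.
Let `A` and `B` be the sums of the step costs and of these lower bounds, `D u` the number of
violated pairs at `u` in the optimal clustering and `c u` the size of the cluster of `u`. Comparing
both sides on each triple gives `A + ∑ D² ≤ 3 B` and `2 A ≤ 3 B + 3 ∑ D c`. If no cluster is
`η`-good-on-average, then Cauchy–Schwarz on each cluster gives `η ∑ D c ≤ ∑ D²`, and the three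
inequalities combine to `(2 η + 3) A ≤ (3 η + 9) B`.

The running time rests on the cross pointers: an edge is deleted from both of its adjacency arrays
by moving their last entries into the gaps, so that every edge that meets `C` costs a bounded number
of instructions, and there are at most `∑ v ∈ C, d v` of them.
-/

namespace CorrClust

/-! ### Charging bad triangles -/

section Expectation

theorem expect_map {α β : Type*} [Fintype α] [Fintype β] (p : PMF α) (g : α → β) (f : β → ℝ) :
    expect (p.map g) f = expect p (fun a => f (g a)) := by
  classical
  have toReal_map_apply : ∀ b, (p.map g b).toReal = ∑ a, if b = g a then (p a).toReal else 0 := by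
    intro b
    rw [PMF.map_apply, tsum_fintype, ENNReal.toReal_sum]
    · exact Finset.sum_congr rfl fun a _ => by split_ifs <;> rfl
    · intro a _
      split_ifs
      exacts [p.apply_ne_top a, ENNReal.zero_ne_top]
  simp only [expect, toReal_map_apply, Finset.sum_mul]
  rw [Finset.sum_comm]
  simp [ite_mul]

theorem expect_nonneg {α : Type*} [Fintype α] (p : PMF α) {f : α → ℝ} (hf : ∀ a, 0 ≤ f a) :
    0 ≤ expect p f :=
  Finset.sum_nonneg fun a _ => mul_nonneg ENNReal.toReal_nonneg (hf a)

theorem expect_pivotStep {V : Type*} [Fintype V] [DecidableEq V] [Nonempty V]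
    (G : SimpleGraph V) (f : Finset V → ℝ) :
    expect (pivotStep G) f = (Fintype.card V : ℝ)⁻¹ * ∑ u, f (nbhd G u) := by
  rw [pivotStep, expect_map]
  simp [expect, PMF.uniformOfFintype_apply, Finset.mul_sum]

end Expectation

section CyclicSums

variable {V M : Type*}

/-- The sum of `f` over the three rotations of `(u, v, w)`: inequalities between triple sums are
proved one cyclically ordered triple at a time. -/
def cyclicSum [Add M] (f : V → V → V → M) (u v w : V) : M :=
  f u v w + f v w u + f w u v

theorem cyclicSum_rotate [AddCommMonoid M] (f : V → V → V → M) (u v w : V) :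
    cyclicSum f v w u = cyclicSum f u v w := by
  rw [cyclicSum, cyclicSum, add_comm, add_assoc]

theorem sum_cyclicSum [Fintype V] [AddCommMonoid M] (f : V → V → V → M) :
    ∑ u, ∑ v, ∑ w, cyclicSum f u v w = 3 • ∑ u, ∑ v, ∑ w, f u v w := by
  have rotate : ∑ u, ∑ v, ∑ w, f v w u = ∑ u, ∑ v, ∑ w, f u v w :=
    Finset.sum_comm_cycle.symm
  have rotate_twice : ∑ u, ∑ v, ∑ w, f w u v = ∑ u, ∑ v, ∑ w, f u v w :=
    Finset.sum_comm_cycle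
  simp only [cyclicSum, Finset.sum_add_distrib, rotate, rotate_twice]
  rw [succ_nsmul, two_nsmul]

theorem sum_le_sum_of_cyclicSum_le [Fintype V] [AddCommMonoid M] [LinearOrder M]
    [IsOrderedCancelAddMonoid M] {f g : V → V → V → M}
    (h : ∀ u v w, cyclicSum f u v w ≤ cyclicSum g u v w) :
    ∑ u, ∑ v, ∑ w, f u v w ≤ ∑ u, ∑ v, ∑ w, g u v w := by
  rw [← nsmul_le_nsmul_iff_right three_ne_zero, ← sum_cyclicSum, ← sum_cyclicSum]
  exact Finset.sum_le_sum fun u _ => Finset.sum_le_sum fun v _ =>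
    Finset.sum_le_sum fun w _ => h u v w

theorem forall_triple_of_rotate {p : V → V → V → Prop} (rotate : ∀ u v w, p v w u → p u v w)
    (repeated : ∀ u w, p u u w)
    (distinct : ∀ u v w, u ≠ v → u ≠ w → v ≠ w → p u v w) (u v w : V) : p u v w := by
  by_cases huv : u = v
  · exact huv ▸ repeated u w
  by_cases huw : u = w
  · exact huw ▸ rotate _ _ _ (rotate _ _ _ (repeated u v))
  by_cases hvw : v = w
  · exact hvw ▸ rotate _ _ _ (repeated v u)
  exact distinct u v w huv huw hvw

end CyclicSums

section Disagreements

variable {V : Type*}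

open Classical in
theorem two_mul_ncard_sym2 [Fintype V] (E : Set (Sym2 V)) (hE : ∀ v, s(v, v) ∉ E) :
    (2 * E.ncard : ℤ) = ∑ v, ∑ w, if s(v, w) ∈ E then 1 else 0 := by
  have edgeSet_eq : (SimpleGraph.fromEdgeSet E).edgeSet = E := by
    rw [SimpleGraph.edgeSet_fromEdgeSet, sdiff_eq_left, Set.disjoint_left]
    rintro ⟨v, w⟩ he (rfl : v = w)
    exact hE v he
  have handshake := (SimpleGraph.fromEdgeSet E).sum_degrees_eq_twice_card_edges
  rw [← Set.ncard_coe_finset, SimpleGraph.coe_edgeFinset, edgeSet_eq] at handshake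
  have degree_eq : ∀ v, ((SimpleGraph.fromEdgeSet E).degree v : ℤ) =
      ∑ w, if s(v, w) ∈ E then 1 else 0 := by
    intro v
    rw [← SimpleGraph.card_neighborFinset_eq_degree, Finset.sum_boole]
    congr 2
    ext w
    simp [← SimpleGraph.mem_edgeSet, edgeSet_eq, -SimpleGraph.fromEdgeSet_adj]
  simp only [← degree_eq]
  exact_mod_cast handshake.symm

open Classical in
/-- The indicator of the pair `v, w` being violated when the classes of `r` are the clusters. -/
noncomputable def disagreement (G : SimpleGraph V) (r : Setoid V) (v w : V) : ℤ :=
  if v ≠ w ∧ (G.Adj v w ↔ ¬ r v w) then 1 else 0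

open Classical in
/-- The indicator of the pair `v, w` being violated when the cluster `C` is removed. -/
noncomputable def stepDisagreement (G : SimpleGraph V) (C : Finset V) (v w : V) : ℤ :=
  if (G.Adj v w ∧ ¬ (v ∈ C ↔ w ∈ C)) ∨ (v ≠ w ∧ ¬ G.Adj v w ∧ v ∈ C ∧ w ∈ C) then 1 else 0

theorem disagreement_self (G : SimpleGraph V) (r : Setoid V) (v : V) :
    disagreement G r v v = 0 := by
  simp [disagreement]

open Classical in
theorem disagreement_comap {W : Type*} (G : SimpleGraph V) (r : Setoid V) {f : W → V}
    (hf : f.Injective) (v w : W) :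
    disagreement (G.comap f) (r.comap f) v w = disagreement G r (f v) (f w) :=
  if_congr (and_congr hf.ne_iff.symm Iff.rfl) rfl rfl

open Classical in
theorem disagreement_comm (G : SimpleGraph V) (r : Setoid V) (v w : V) :
    disagreement G r v w = disagreement G r w v :=
  if_congr (by rw [ne_comm, G.adj_comm, r.comm']) rfl rfl

theorem stepDisagreement_self (G : SimpleGraph V) (C : Finset V) (v : V) :
    stepDisagreement G C v v = 0 := by
  simp [stepDisagreement]

open Classical in
theorem stepDisagreement_comm (G : SimpleGraph V) (C : Finset V) (v w : V) :
    stepDisagreement G C v w = stepDisagreement G C w v :=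
  if_congr (by rw [G.adj_comm, iff_comm (a := v ∈ C), ne_comm, and_comm (a := v ∈ C)]) rfl rfl

theorem two_mul_stepCost [Fintype V] (G : SimpleGraph V) (C : Finset V) :
    (2 * stepCost G C : ℤ) = ∑ v, ∑ w, stepDisagreement G C v w := by
  classical
  rw [stepCost, Nat.cast_add, mul_add, two_mul_ncard_sym2 _ (by simp),
    two_mul_ncard_sym2 _ (by simp)]
  simp only [← Finset.sum_add_distrib]
  refine Finset.sum_congr rfl fun v _ => Finset.sum_congr rfl fun w _ => ?_
  simp only [Set.mem_ofPred_eq, SimpleGraph.mem_edgeSet, SimpleGraph.compl_adj, Sym2.mem_iff,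
    forall_eq_or_imp, forall_eq, exists_eq_or_imp, exists_eq_left, stepDisagreement]
  rcases eq_or_ne v w with rfl | hvw
  · simp
  · by_cases hadj : G.Adj v w <;> by_cases hv : v ∈ C <;> by_cases hw : w ∈ C <;>
      simp [hvw, hadj, hv, hw]

variable [Fintype V] [DecidableEq V]

/-- The equivalence relation whose classes are the clusters of `P`. -/
def clusterSetoid (P : Clustering V) : Setoid V :=
  Setoid.ker P.part

theorem clusterSetoid_iff_mem_part {P : Clustering V} {v w : V} :
    clusterSetoid P v w ↔ w ∈ P.part v := by
  rw [clusterSetoid, Setoid.ker_def, eq_comm, ← P.mem_part_iff_part_eq_part (Finset.mem_univ w)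
    (Finset.mem_univ v)]

theorem clusterSetoid_iff_exists {P : Clustering V} {v w : V} :
    clusterSetoid P v w ↔ ∃ C ∈ P.parts, v ∈ C ∧ w ∈ C := by
  simp only [clusterSetoid_iff_mem_part, P.mem_part_iff_exists, and_comm]

theorem clusterSetoid_ofSetoid (r : Setoid V) [DecidableRel r] :
    clusterSetoid (Finpartition.ofSetoid r) = r := by
  ext v w
  rw [clusterSetoid_iff_mem_part, Finpartition.mem_part_ofSetoid_iff_rel]

theorem two_mul_cost (G : SimpleGraph V) (P : Clustering V) :
    (2 * cost G P : ℤ) = ∑ v, ∑ w, disagreement G (clusterSetoid P) v w := by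
  classical
  rw [cost, Nat.cast_add, mul_add, two_mul_ncard_sym2 _ (by simp), two_mul_ncard_sym2 _ (by simp)]
  simp only [← Finset.sum_add_distrib]
  refine Finset.sum_congr rfl fun v _ => Finset.sum_congr rfl fun w _ => ?_
  simp only [Set.mem_ofPred_eq, SimpleGraph.mem_edgeSet, SimpleGraph.compl_adj, Sym2.mem_iff,
    forall_eq_or_imp, forall_eq, ← clusterSetoid_iff_exists, disagreement]
  rcases eq_or_ne v w with rfl | hvw
  · simp
  · by_cases hadj : G.Adj v w <;> by_cases hr : clusterSetoid P v w <;> simp [hvw, hadj, hr]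

theorem IsOptimal.optCost_eq {G : SimpleGraph V} {P : Clustering V} (hP : IsOptimal G P) :
    optCost G = cost G P :=
  le_antisymm (Nat.sInf_le ⟨P, rfl⟩)
    (le_csInf (Set.range_nonempty_iff_nonempty.2 ⟨P⟩) (Set.forall_mem_range.2 hP))

theorem two_mul_optCost_le (G : SimpleGraph V) (r : Setoid V) :
    (2 * optCost G : ℤ) ≤ ∑ v, ∑ w, disagreement G r v w := by
  classical
  have le_cost : optCost G ≤ cost G (Finpartition.ofSetoid r) := Nat.sInf_le ⟨_, rfl⟩
  rw [← clusterSetoid_ofSetoid r, ← two_mul_cost]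
  exact_mod_cast Nat.mul_le_mul_left 2 le_cost

theorem two_mul_optCost_remaining_le (G : SimpleGraph V) (C : Finset V) (r : Setoid V) :
    (2 * optCost (remaining G C) : ℤ) ≤
      ∑ v, ∑ w, if v ∉ C ∧ w ∉ C then disagreement G r v w else 0 := by
  have sum_subtype : ∀ f : V → ℤ, ∑ v : {v : V // v ∉ C}, f v = ∑ v, if v ∉ C then f v else 0 :=
    fun f => by rw [← Finset.sum_filter]; exact (Finset.sum_subtype _ (by simp) f).symm
  refine (two_mul_optCost_le _ (r.comap Subtype.val)).trans_eq ?_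
  simp only [disagreement_comap G r Subtype.val_injective]
  rw [Finset.sum_congr rfl fun (v : {v // v ∉ C}) _ => sum_subtype (disagreement G r v),
    sum_subtype fun v => ∑ w, if w ∉ C then disagreement G r v w else 0]
  refine Finset.sum_congr rfl fun v _ => ?_
  by_cases hv : v ∈ C <;> simp [hv]

end Disagreements

section Savings

variable {V : Type*}

/-- The relation `r` after the class of `u` has been broken into singletons. -/
def breakClass (r : Setoid V) (u : V) : Setoid V where
  r v w := v = w ∨ (r v w ∧ ¬ r u v)
  iseqv :=
    { refl := fun v => Or.inl rfl
      symm := by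
        rintro v w (rfl | ⟨hvw, huv⟩)
        · exact Or.inl rfl
        · exact Or.inr ⟨r.symm hvw, fun huw => huv (r.trans huw (r.symm hvw))⟩
      trans := by
        rintro v w x (rfl | ⟨hvw, huv⟩) (rfl | ⟨hwx, huw⟩)
        · exact Or.inl rfl
        · exact Or.inr ⟨hwx, huw⟩
        · exact Or.inr ⟨hvw, huv⟩
        · exact Or.inr ⟨r.trans hvw hwx, huv⟩ }

theorem breakClass_iff {r : Setoid V} {u v w : V} :
    breakClass r u v w ↔ v = w ∨ (r v w ∧ ¬ r u v) :=
  Iff.rfl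

variable [Fintype V] [DecidableEq V]

theorem mem_nbhd {G : SimpleGraph V} {u v : V} : v ∈ nbhd G u ↔ v = u ∨ G.Adj u v := by
  simp [nbhd]

/-- How much the pair `v, w` contributes to the decrease of the optimum after pivot `u`, when the
remaining graph is clustered by `breakClass r u`. -/
noncomputable def optSaving (G : SimpleGraph V) (r : Setoid V) (u v w : V) : ℤ :=
  disagreement G r v w -
    if v ∉ nbhd G u ∧ w ∉ nbhd G u then disagreement G (breakClass r u) v w else 0

theorem sum_optSaving_le {G : SimpleGraph V} {P : Clustering V} (hP : IsOptimal G P) (u : V) :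
    ((∑ v, ∑ w, optSaving G (clusterSetoid P) u v w : ℤ) : ℝ) ≤
      2 * optDecrease G (nbhd G u) := by
  have rest := two_mul_optCost_remaining_le G (nbhd G u) (breakClass (clusterSetoid P) u)
  simp only [optSaving, Finset.sum_sub_distrib, ← two_mul_cost]
  rw [optDecrease, hP.optCost_eq]
  have rest_real := (Int.cast_le (R := ℝ)).2 rest
  push_cast at rest_real ⊢
  linarith

theorem optSaving_comm (G : SimpleGraph V) (r : Setoid V) (u v w : V) :
    optSaving G r u v w = optSaving G r u w v := by
  simp only [optSaving, disagreement_comm _ _ v w, and_comm (a := v ∉ nbhd G u)]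

theorem optSaving_self (G : SimpleGraph V) (r : Setoid V) (u v : V) :
    optSaving G r u v v = 0 := by
  simp [optSaving, disagreement_self]

theorem optSaving_pivot (G : SimpleGraph V) (r : Setoid V) (u v : V) :
    optSaving G r u u v = disagreement G r u v := by
  simp [optSaving, mem_nbhd]

theorem stepDisagreement_pivot (G : SimpleGraph V) (u v : V) :
    stepDisagreement G (nbhd G u) u v = 0 := by
  by_cases hadj : G.Adj u v <;> simp +contextual [stepDisagreement, mem_nbhd, hadj, eq_comm]

end Savings

section Triples

variable {V : Type*}

open Classical in
/-- The indicator of a relation, as an integer. -/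
noncomputable def indicator (r : V → V → Prop) (v w : V) : ℤ :=
  if r v w then 1 else 0

theorem indicator_eq_zero_or_one (r : V → V → Prop) (v w : V) :
    indicator r v w = 0 ∨ indicator r v w = 1 := by
  unfold indicator
  split_ifs <;> simp

open Classical in
theorem indicator_adj_comm (G : SimpleGraph V) (v w : V) :
    indicator G.Adj v w = indicator G.Adj w v :=
  if_congr (G.adj_comm v w) rfl rfl

open Classical in
theorem indicator_setoid_comm (r : Setoid V) (v w : V) : indicator r v w = indicator r w v :=
  if_congr r.comm' rfl rfl

theorem indicator_setoid_cases (r : Setoid V) (u v w : V) :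
    (indicator r u v, indicator r u w, indicator r v w) ∈
      ({(0, 0, 0), (1, 0, 0), (0, 1, 0), (0, 0, 1), (1, 1, 1)} : Set (ℤ × ℤ × ℤ)) := by
  by_cases huv : r u v
  · have : r u w ↔ r v w := ⟨r.trans (r.symm huv), r.trans huv⟩
    by_cases hvw : r v w <;> simp [indicator, huv, this, hvw]
  · have : r u w → ¬ r v w := fun huw hvw => huv (r.trans huw (r.symm hvw))
    by_cases huw : r u w
    · simp [indicator, huv, huw, this huw]
    · by_cases hvw : r v w <;> simp [indicator, huv, huw, hvw]

theorem disagreement_eq_zero_or_one (G : SimpleGraph V) (r : Setoid V) (v w : V) :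
    disagreement G r v w = 0 ∨ disagreement G r v w = 1 := by
  unfold disagreement
  split_ifs <;> simp

theorem disagreement_of_ne {G : SimpleGraph V} {r : Setoid V} {v w : V} (hvw : v ≠ w) :
    disagreement G r v w =
      indicator G.Adj v w + indicator r v w - 2 * indicator G.Adj v w * indicator r v w := by
  by_cases hadj : G.Adj v w <;> by_cases hr : r v w <;>
    simp [disagreement, indicator, hvw, hadj, hr]

variable [Fintype V] [DecidableEq V]

/- A pivot at any vertex of a triple violates the opposite pair exactly if the triple is a bad
triangle, that is, has exactly two edges. -/
theorem stepDisagreement_nbhd {G : SimpleGraph V} {u v w : V} (huv : u ≠ v) (huw : u ≠ w)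
    (hvw : v ≠ w) :
    stepDisagreement G (nbhd G u) v w =
      indicator G.Adj u v * indicator G.Adj u w * (1 - indicator G.Adj v w) +
      indicator G.Adj u v * (1 - indicator G.Adj u w) * indicator G.Adj v w +
      (1 - indicator G.Adj u v) * indicator G.Adj u w * indicator G.Adj v w := by
  by_cases h₁ : G.Adj u v <;> by_cases h₂ : G.Adj u w <;> by_cases h₃ : G.Adj v w <;>
    simp [stepDisagreement, indicator, mem_nbhd, hvw, huv.symm, huw.symm, h₁, h₂, h₃]

theorem optSaving_of_ne {G : SimpleGraph V} {r : Setoid V} {u v w : V} (huv : u ≠ v)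
    (huw : u ≠ w) (hvw : v ≠ w) :
    optSaving G r u v w = disagreement G r v w -
      (1 - indicator G.Adj u v) * (1 - indicator G.Adj u w) *
        (indicator G.Adj v w + indicator r v w * (1 - indicator r u v) *
          (1 - 2 * indicator G.Adj v w)) := by
  by_cases h₁ : G.Adj u v <;> by_cases h₂ : G.Adj u w <;> by_cases h₃ : G.Adj v w <;>
    by_cases h₄ : r u v <;> by_cases h₅ : r v w <;>
    simp [optSaving, disagreement, breakClass_iff, indicator, mem_nbhd, hvw, huv.symm, huw.symm,
      h₁, h₂, h₃, h₄, h₅]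

/- Let `D` be the number of violated pairs of a triple. If the triple has two or three edges, then
each pivot removes the opposite pair, the savings sum to `D`, and the claim is
`3 [two edges] + D (D - 1) ≤ 3 D`, where `D ≠ 0` for a bad triangle. -/
theorem cyclicSum_stepDisagreement_add_le (G : SimpleGraph V) (r : Setoid V) (u v w : V) :
    cyclicSum (fun u v w => stepDisagreement G (nbhd G u) v w +
        2 * (disagreement G r u v * disagreement G r u w)) u v w ≤
      cyclicSum (fun u v w => 3 * optSaving G r u v w) u v w := by
  induction u, v, w using forall_triple_of_rotate with
  | rotate u v w h => rwa [cyclicSum_rotate _ u, cyclicSum_rotate _ u] at h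
  | repeated u w =>
    simp only [cyclicSum, stepDisagreement_pivot, stepDisagreement_self, optSaving_pivot,
      optSaving_self, disagreement_self, stepDisagreement_comm _ _ w u, optSaving_comm _ _ u w u,
      disagreement_comm _ _ w u]
    rcases disagreement_eq_zero_or_one G r u w with h | h <;> norm_num [h]
  | distinct u v w huv huw hvw =>
    simp only [cyclicSum, stepDisagreement_nbhd, optSaving_of_ne, disagreement_of_ne, huv, huw, hvw,
      huv.symm, huw.symm, hvw.symm, ne_eq, not_false_eq_true, indicator_adj_comm G v u,
      indicator_adj_comm G w u, indicator_adj_comm G w v, indicator_setoid_comm r v u,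
      indicator_setoid_comm r w u, indicator_setoid_comm r w v]
    have hr := indicator_setoid_cases r u v w
    simp only [Set.mem_insert_iff, Set.mem_singleton_iff, Prod.mk.injEq] at hr
    rcases hr with hr | hr | hr | hr | hr <;>
    rcases indicator_eq_zero_or_one G.Adj u v with euv | euv <;>
    rcases indicator_eq_zero_or_one G.Adj u w with euw | euw <;>
    rcases indicator_eq_zero_or_one G.Adj v w with evw | evw <;>
    norm_num [hr, euv, euw, evw]

/- For a bad triangle the left side is `6` and the savings sum to the number `D` of its violated
pairs, so the claim needs an extra term only if `D = 1`; then the violated pair shares a vertex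
with a pair inside a cluster. -/
theorem two_mul_cyclicSum_stepDisagreement_le (G : SimpleGraph V) (r : Setoid V) (u v w : V) :
    cyclicSum (fun u v w => 2 * stepDisagreement G (nbhd G u) v w) u v w ≤
      cyclicSum (fun u v w => 3 * optSaving G r u v w +
        3 * (disagreement G r u v * indicator r u w +
          disagreement G r u w * indicator r u v)) u v w := by
  induction u, v, w using forall_triple_of_rotate with
  | rotate u v w h => rwa [cyclicSum_rotate _ u, cyclicSum_rotate _ u] at h
  | repeated u w =>
    simp only [cyclicSum, stepDisagreement_pivot, stepDisagreement_self, optSaving_pivot,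
      optSaving_self, disagreement_self, stepDisagreement_comm _ _ w u, optSaving_comm _ _ u w u,
      disagreement_comm _ _ w u]
    rcases disagreement_eq_zero_or_one G r u w with h | h <;>
    rcases indicator_eq_zero_or_one r u u with hu | hu <;>
    rcases indicator_eq_zero_or_one r w u with hw | hw <;> norm_num [h, hu, hw]
  | distinct u v w huv huw hvw =>
    simp only [cyclicSum, stepDisagreement_nbhd, optSaving_of_ne, disagreement_of_ne, huv, huw, hvw,
      huv.symm, huw.symm, hvw.symm, ne_eq, not_false_eq_true, indicator_adj_comm G v u,
      indicator_adj_comm G w u, indicator_adj_comm G w v, indicator_setoid_comm r v u,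
      indicator_setoid_comm r w u, indicator_setoid_comm r w v]
    have hr := indicator_setoid_cases r u v w
    simp only [Set.mem_insert_iff, Set.mem_singleton_iff, Prod.mk.injEq] at hr
    rcases hr with hr | hr | hr | hr | hr <;>
    rcases indicator_eq_zero_or_one G.Adj u v with euv | euv <;>
    rcases indicator_eq_zero_or_one G.Adj u w with euw | euw <;>
    rcases indicator_eq_zero_or_one G.Adj v w with evw | evw <;>
    norm_num [hr, euv, euw, evw]

end Triples

section ExpectedCost

variable {V : Type*} [Fintype V] [DecidableEq V]

theorem two_mul_sum_stepCost_add_le (G : SimpleGraph V) (r : Setoid V) :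
    2 * ∑ u, (stepCost G (nbhd G u) : ℤ) + 2 * ∑ u, (∑ v, disagreement G r u v) ^ 2 ≤
      3 * ∑ u, ∑ v, ∑ w, optSaving G r u v w := by
  have h := sum_le_sum_of_cyclicSum_le (cyclicSum_stepDisagreement_add_le G r)
  simp only [Finset.sum_add_distrib, ← Finset.mul_sum, ← two_mul_stepCost] at h
  simpa only [pow_two, Finset.sum_mul_sum, ← Finset.mul_sum] using h

theorem four_mul_sum_stepCost_le (G : SimpleGraph V) (r : Setoid V) :
    4 * ∑ u, (stepCost G (nbhd G u) : ℤ) ≤ 3 * ∑ u, ∑ v, ∑ w, optSaving G r u v w +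
      6 * ∑ u, (∑ v, disagreement G r u v) * ∑ v, indicator r u v := by
  have h := sum_le_sum_of_cyclicSum_le (two_mul_cyclicSum_stepDisagreement_le G r)
  simp only [Finset.sum_add_distrib, ← Finset.mul_sum, ← Finset.sum_mul, ← two_mul_stepCost] at h
  linarith

theorem sum_disagreement_clusterSetoid (G : SimpleGraph V) (P : Clustering V) (u : V) :
    ∑ v, disagreement G (clusterSetoid P) u v = (nbhd G u ∆ P.part u).card := by
  classical
  simp only [disagreement, clusterSetoid_iff_mem_part, Finset.sum_boole]
  congr 2
  ext v
  simp only [Finset.mem_filter_univ, Finset.mem_symmDiff, mem_nbhd]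
  rcases eq_or_ne u v with rfl | huv
  · simp
  · by_cases hadj : G.Adj u v <;> by_cases hv : v ∈ P.part u <;>
      simp [huv, huv.symm, hadj, hv]

theorem sum_indicator_clusterSetoid (P : Clustering V) (u : V) :
    ∑ v, indicator (clusterSetoid P) u v = (P.part u).card := by
  classical
  simp only [indicator, clusterSetoid_iff_mem_part, Finset.sum_boole]
  simp

theorem mul_sum_mul_card_le_sum_sq {ι : Type*} {C : Finset ι} {f : ι → ℝ} (hf : ∀ i ∈ C, 0 ≤ f i)
    {η : ℝ} (h : η * (C.card : ℝ) ^ 2 ≤ ∑ i ∈ C, f i) :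
    η * ((∑ i ∈ C, f i) * C.card) ≤ ∑ i ∈ C, f i ^ 2 := by
  rcases C.eq_empty_or_nonempty with rfl | hC
  · simp
  refine le_of_mul_le_mul_left ?_ (Nat.cast_pos (α := ℝ).2 hC.card_pos)
  calc (C.card : ℝ) * (η * ((∑ i ∈ C, f i) * C.card))
      = (∑ i ∈ C, f i) * (η * (C.card : ℝ) ^ 2) := by ring
    _ ≤ (∑ i ∈ C, f i) * ∑ i ∈ C, f i :=
        mul_le_mul_of_nonneg_left h (Finset.sum_nonneg hf)
    _ = (∑ i ∈ C, f i) ^ 2 := (sq _).symm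
    _ ≤ C.card * ∑ i ∈ C, f i ^ 2 := sq_sum_le_card_mul_sum_sq

theorem mul_sum_card_symmDiff_mul_card_le {G : SimpleGraph V} {P : Clustering V} {η : ℝ}
    (hP : ∀ C ∈ P.parts, ¬ GoodOnAverage G η C) :
    η * ∑ u, ((nbhd G u ∆ P.part u).card : ℝ) * (P.part u).card ≤
      ∑ u, ((nbhd G u ∆ P.part u).card : ℝ) ^ 2 := by
  have sum_clusters : ∀ f : V → ℝ, ∑ u, f u = ∑ C ∈ P.parts, ∑ u ∈ C, f u := fun f => by
    simpa only [P.biUnion_parts, id] using Finset.sum_biUnion (f := f) P.disjoint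
  rw [sum_clusters, sum_clusters, Finset.mul_sum]
  refine Finset.sum_le_sum fun C hC => ?_
  have part_eq : ∀ u ∈ C, P.part u = C := fun u hu => P.part_eq_of_mem hC hu
  have not_good := lt_of_not_ge (hP C hC)
  push_cast at not_good
  calc η * ∑ u ∈ C, ((nbhd G u ∆ P.part u).card : ℝ) * (P.part u).card
      = η * ((∑ u ∈ C, ((nbhd G u ∆ C).card : ℝ)) * C.card) := by
        rw [Finset.sum_mul, Finset.sum_congr rfl fun u hu => by rw [part_eq u hu]]
    _ ≤ ∑ u ∈ C, ((nbhd G u ∆ C).card : ℝ) ^ 2 :=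
        mul_sum_mul_card_le_sum_sq (fun _ _ => Nat.cast_nonneg _) not_good.le
    _ = ∑ u ∈ C, ((nbhd G u ∆ P.part u).card : ℝ) ^ 2 :=
        Finset.sum_congr rfl fun u hu => by rw [part_eq u hu]

theorem sum_stepCost_le {G : SimpleGraph V} {P : Clustering V} {η : ℝ} (hη : 0 ≤ η)
    (hopt : IsOptimal G P) (hP : ∀ C ∈ P.parts, ¬ GoodOnAverage G η C) :
    (2 * η + 3) * ∑ u, (stepCost G (nbhd G u) : ℝ) ≤
      (3 * η + 9) * ∑ u, optDecrease G (nbhd G u) := by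
  have h₁ := two_mul_sum_stepCost_add_le G (clusterSetoid P)
  have h₂ := four_mul_sum_stepCost_le G (clusterSetoid P)
  have h₃ := mul_sum_card_symmDiff_mul_card_le hP
  have saving : ((∑ u, ∑ v, ∑ w, optSaving G (clusterSetoid P) u v w : ℤ) : ℝ) ≤
      2 * ∑ u, optDecrease G (nbhd G u) := by
    rw [Int.cast_sum, Finset.mul_sum]
    exact Finset.sum_le_sum fun u _ => sum_optSaving_le hopt u
  simp only [sum_disagreement_clusterSetoid, sum_indicator_clusterSetoid] at h₁ h₂
  generalize ∑ u, ∑ v, ∑ w, optSaving G (clusterSetoid P) u v w = Y at h₁ h₂ saving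
  rify at h₁ h₂
  nlinarith [mul_le_mul_of_nonneg_left h₂ hη, mul_le_mul_of_nonneg_left saving hη]

theorem expect_stepCost_le [Nonempty V] {G : SimpleGraph V} {P : Clustering V} {η : ℝ}
    (hη : 0 ≤ η) (hopt : IsOptimal G P) (hP : ∀ C ∈ P.parts, ¬ GoodOnAverage G η C) :
    expect (pivotStep G) (fun C => (stepCost G C : ℝ)) ≤
      (3 - η / (2 / 3 * η + 1)) * expect (pivotStep G) (optDecrease G) := by
  have factor : 3 - η / (2 / 3 * η + 1) = (3 * η + 9) / (2 * η + 3) := by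
    field_simp
    ring
  rw [expect_pivotStep, expect_pivotStep, mul_left_comm, factor, div_mul_eq_mul_div]
  refine mul_le_mul_of_nonneg_left ?_ (by positivity)
  rw [le_div_iff₀' (by positivity)]
  exact sum_stepCost_le hη hopt hP

theorem le_five_sixths_of_le_two_thirds {η a z : ℝ} (hη : 0 ≤ η) (ha : 0 ≤ a)
    (h : a ≤ (3 - η / (2 / 3 * η + 1)) * z) : a ≤ (3 - η / (5 / 6 * η + 1)) * z := by
  have ratio_lt : η / (2 / 3 * η + 1) < 3 := by
    rw [div_lt_iff₀ (by positivity)]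
    linarith
  have hz : 0 ≤ z := nonneg_of_mul_nonneg_right (ha.trans h) (sub_pos.2 ratio_lt)
  refine h.trans (mul_le_mul_of_nonneg_right ?_ hz)
  gcongr 3 - η / (?_ * η + 1)
  norm_num

end ExpectedCost

/-! ### Execution of programs -/

section Execution

variable {P : Program}

/-- The law of the configuration `n` steps after the configuration `c`. -/
noncomputable def runFrom (P : Program) : ℕ → Config → PMF Config
  | 0, c => PMF.pure c
  | n + 1, c => (step P c).bind (runFrom P n)

theorem runFrom_add (P : Program) (m n : ℕ) (c : Config) :
    runFrom P (m + n) c = (runFrom P m c).bind (runFrom P n) := by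
  induction m generalizing c with
  | zero => rw [Nat.zero_add, runFrom, PMF.pure_bind]
  | succ m ih =>
    rw [Nat.succ_add, runFrom, runFrom, PMF.bind_bind]
    exact congrArg _ (funext ih)

theorem run_eq_runFrom (P : Program) (M : Memory) (N : ℕ) :
    run P M N = runFrom P N ⟨M, 0, 0⟩ := by
  induction N with
  | zero => rfl
  | succ N ih =>
    rw [run, ih, runFrom_add]
    exact congrArg _ (funext fun c => (PMF.bind_pure _).symm)

theorem runFrom_of_halted {c : Config} (h : Halted P c) (n : ℕ) :
    runFrom P n c = PMF.pure c := by
  induction n with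
  | zero => rfl
  | succ n ih => rw [runFrom, step, List.getElem?_eq_none h, PMF.pure_bind, ih]

/-- In exactly `n` deterministic steps, `P` passes from instruction `pc` with memory `M` to
instruction `pc'` with memory `M'`. -/
def Reaches (P : Program) (pc : ℕ) (M : Memory) (n pc' : ℕ) (M' : Memory) : Prop :=
  ∀ t, runFrom P n ⟨M, pc, t⟩ = PMF.pure ⟨M', pc', t + n⟩

theorem Reaches.refl (P : Program) (pc : ℕ) (M : Memory) : Reaches P pc M 0 pc M :=
  fun _ => rfl

theorem Reaches.trans {pc₁ pc₂ pc₃ m n : ℕ} {M₁ M₂ M₃ : Memory} (h : Reaches P pc₁ M₁ m pc₂ M₂)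
    (h' : Reaches P pc₂ M₂ n pc₃ M₃) : Reaches P pc₁ M₁ (m + n) pc₃ M₃ := fun t => by
  rw [runFrom_add, h t, PMF.pure_bind, h' (t + m), add_assoc]

theorem Reaches.of_step {pc pc' : ℕ} {M M' : Memory}
    (h : ∀ t, step P ⟨M, pc, t⟩ = PMF.pure ⟨M', pc', t + 1⟩) : Reaches P pc M 1 pc' M' :=
  fun t => by rw [runFrom, h t, PMF.pure_bind, runFrom]

theorem reaches_jumpEq_of_eq {pc r s l : ℕ} {M : Memory} (hi : P[pc]? = some (.jumpEq r s l))
    (h : M.reg r = M.reg s) : Reaches P pc M 1 l M :=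
  .of_step fun t => by simp [step, hi, exec, h]

theorem reaches_jumpEq_of_ne {pc r s l : ℕ} {M : Memory} (hi : P[pc]? = some (.jumpEq r s l))
    (h : M.reg r ≠ M.reg s) : Reaches P pc M 1 (pc + 1) M :=
  .of_step fun t => by simp [step, hi, exec, h]

/-- The instructions that neither jump nor draw a random number. -/
def Instr.isAssignment : Instr → Bool
  | .jumpEq .. | .rand .. => false
  | _ => true

/-- The memory after the assignment `i`; jumps and random draws are given the junk value `M`. -/
def Memory.assign (M : Memory) : Instr → Memory
  | .const r k => M.setReg r k
  | .copy r s => M.setReg r (M.reg s)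
  | .inc r => M.setReg r (M.reg r + 1)
  | .dec r => M.setReg r (M.reg r - 1)
  | .load r a s => M.setReg r (M.arr a (M.reg s))
  | .store a s r => M.setArr a (M.reg s) (M.reg r)
  | .jumpEq .. | .rand .. => M

/-- The memory after a block of assignments. -/
def Memory.assignAll (M : Memory) (B : List Instr) : Memory :=
  B.foldl Memory.assign M

theorem exec_of_isAssignment (c : Config) {i : Instr} (hi : i.isAssignment) :
    exec c i = PMF.pure (c.next (c.mem.assign i)) := by
  cases i <;> first | rfl | cases hi

theorem reaches_block (B : List Instr) (hB : B.all Instr.isAssignment) {pc : ℕ}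
    (hpc : B <+: P.drop pc) (M : Memory) :
    Reaches P pc M B.length (pc + B.length) (M.assignAll B) := by
  induction B generalizing pc M with
  | nil => exact .refl P pc M
  | cons i B ih =>
    obtain ⟨hi, hB⟩ := (Bool.and_eq_true _ _).mp hB
    obtain ⟨T, hT⟩ := hpc
    have hget : P[pc]? = some i := by
      rw [← Nat.add_zero pc, ← List.getElem?_drop, ← hT]; rfl
    have htail : B <+: P.drop (pc + 1) := ⟨T, by rw [← List.drop_drop, ← hT]; rfl⟩
    have hfirst : Reaches P pc M 1 (pc + 1) (M.assign i) :=
      .of_step fun t => by simp only [step, hget]; exact exec_of_isAssignment _ hi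
    have := hfirst.trans (ih hB htail (M.assign i))
    rwa [add_assoc, Nat.add_comm 1] at this

end Execution

section Program

/-- Registers 2, 3, 4 := the vertex at position `reg 2`, its first slot, the end of its slots;
the output is reset. -/
def openPivot : List Instr :=
  [.load 2 0 2, .load 3 2 2, .load 4 3 2, .const 1 0]

/-- Appends the vertex in register 2 to the output. -/
def emitVertex : List Instr :=
  [.store 6 1 2, .inc 1]

/-- Register 2 := the target of the slot in register 3, which moves on to the next slot. -/
def nextTarget : List Instr :=
  [.load 2 4 3, .inc 3]

/-- Register 5 := the number of output vertices still to be removed; register 6 := 0. -/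
def startRemoval : List Instr :=
  [.copy 5 1, .const 6 0]

/-- Registers 2, 3, 4 := the last output vertex still to be removed, its first slot, the end of
its slots. -/
def popOutput : List Instr :=
  [.dec 5, .load 2 6 5, .load 3 2 2, .load 4 3 2]

/-- Deletes the edge in the last slot `s` of the vertex in register 2. Registers 7, 8, 9 hold the
other endpoint `w`, the slot of the edge at `w` and the last slot of `w`; the content of the last
slot of `w` is moved to the slot of the edge. -/
def deleteLastEdge : List Instr :=
  [.dec 4, .load 7 4 4, .load 8 5 4, .load 9 3 7, .dec 9, .load 10 4 9, .load 11 5 9,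
    .store 4 8 10, .store 5 8 11, .store 5 11 8, .store 3 7 9, .store 3 2 4]

/-- Removes the vertex in register 2 from the array of vertices, moving the last vertex to its
position. -/
def deleteVertex : List Instr :=
  [.load 3 1 2, .dec 0, .load 4 0 0, .store 0 3 4, .store 1 4 3]

/-- The pivot step. After the random draw, the loop at 5 outputs the pivot and its neighbours. The
loop at 13 takes the vertices off the output one by one; for each of them the loop at 18 deletes
its edges one by one, after which the vertex itself is removed. -/
def pivotProgram : Program :=
  [.rand 2 0] ++ openPivot ++
    emitVertex ++ [.jumpEq 3 4 11] ++ nextTarget ++ [.jumpEq 0 0 5] ++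
    startRemoval ++
    [.jumpEq 5 6 38] ++ popOutput ++
      [.jumpEq 3 4 32] ++ deleteLastEdge ++ [.jumpEq 0 0 18] ++
      deleteVertex ++ [.jumpEq 0 0 13]

theorem reaches_openPivot (M : Memory) :
    Reaches pivotProgram 1 M 4 5 (M.assignAll openPivot) :=
  reaches_block openPivot rfl ⟨_, rfl⟩ M

theorem reaches_emitVertex (M : Memory) :
    Reaches pivotProgram 5 M 2 7 (M.assignAll emitVertex) :=
  reaches_block emitVertex rfl ⟨_, rfl⟩ M

theorem reaches_nextTarget {M : Memory} (h : M.reg 3 ≠ M.reg 4) :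
    Reaches pivotProgram 7 M 4 5 (M.assignAll nextTarget) :=
  ((reaches_jumpEq_of_ne rfl h).trans (reaches_block nextTarget rfl ⟨_, rfl⟩ M)).trans
    (reaches_jumpEq_of_eq rfl rfl)

theorem reaches_startRemoval (M : Memory) :
    Reaches pivotProgram 11 M 2 13 (M.assignAll startRemoval) :=
  reaches_block startRemoval rfl ⟨_, rfl⟩ M

theorem reaches_popOutput {M : Memory} (h : M.reg 5 ≠ M.reg 6) :
    Reaches pivotProgram 13 M 5 18 (M.assignAll popOutput) :=
  (reaches_jumpEq_of_ne rfl h).trans (reaches_block popOutput rfl ⟨_, rfl⟩ M)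

theorem reaches_deleteLastEdge {M : Memory} (h : M.reg 3 ≠ M.reg 4) :
    Reaches pivotProgram 18 M 14 18 (M.assignAll deleteLastEdge) :=
  ((reaches_jumpEq_of_ne rfl h).trans (reaches_block deleteLastEdge rfl ⟨_, rfl⟩ M)).trans
    (reaches_jumpEq_of_eq rfl rfl)

theorem reaches_deleteVertex (M : Memory) :
    Reaches pivotProgram 32 M 6 13 (M.assignAll deleteVertex) :=
  (reaches_block deleteVertex rfl ⟨_, rfl⟩ M).trans (reaches_jumpEq_of_eq rfl rfl)

end Program

theorem bijOn_update_Iio {α : Type*} {f : ℕ → α} {n : ℕ} {S : Set α} {x : α}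
    (h : Set.BijOn f (Set.Iio n) S) (hx : x ∉ S) :
    Set.BijOn (Function.update f n x) (Set.Iio (n + 1)) (insert x S) := by
  have heq : Set.EqOn f (Function.update f n x) (Set.Iio n) := fun i hi =>
    (Function.update_of_ne (ne_of_lt hi) _ _).symm
  rw [← Nat.succ_eq_add_one, ← Nat.succ_eq_succ, Order.Iio_succ_eq_insert]
  simpa only [Function.update_self] using (h.congr heq).insert (a := n) (by simpa using hx)

theorem exists_reaches_emit (k : ℕ) {M : Memory} {S R : Set ℕ} (hk : M.reg 4 = M.reg 3 + k)
    (hS : Set.BijOn M.out (Set.Iio M.outSize) S)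
    (hR : Set.BijOn M.target (Set.Ico (M.reg 3) (M.reg 4)) R)
    (hxS : M.reg 2 ∉ S) (hxR : M.reg 2 ∉ R) (hSR : Disjoint S R) :
    ∃ M', Reaches pivotProgram 5 M (6 * k + 3) 11 M' ∧ M'.size = M.size ∧
      Set.EqOn M'.arr M.arr {6}ᶜ ∧
      Set.BijOn M'.out (Set.Iio M'.outSize) (S ∪ insert (M.reg 2) R) := by
  induction k generalizing M S R with
  | zero =>
    obtain rfl : R = ∅ := by simpa [hk] using hR.image_eq.symm
    refine ⟨_, (reaches_emitVertex M).trans (reaches_jumpEq_of_eq rfl hk.symm), rfl,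
      fun a ha => Function.update_of_ne ha _ _, ?_⟩
    rw [LawfulSingleton.insert_empty_eq, Set.union_singleton]
    exact bijOn_update_Iio hS hxS
  | succ k ih =>
    have hs : M.reg 3 ∈ Set.Ico (M.reg 3) (M.reg 4) := ⟨le_rfl, by lia⟩
    have hmem : M.target (M.reg 3) ∈ R := hR.mapsTo hs
    have hIco : Set.Ico (M.reg 3) (M.reg 4) \ {M.reg 3} = Set.Ico (M.reg 3 + 1) (M.reg 4) := by
      rw [Set.Ico_sdiff_left, Set.Ico_add_one_left_eq_Ioo]
    have hunion : S ∪ insert (M.reg 2) R =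
        insert (M.reg 2) S ∪ insert (M.target (M.reg 3)) (R \ {M.target (M.reg 3)}) := by
      rw [Set.insert_sdiff_singleton, Set.insert_eq_of_mem hmem, Set.union_insert,
        Set.insert_union]
    have hstep := (reaches_emitVertex M).trans
      (reaches_nextTarget (M := M.assignAll emitVertex) (show M.reg 3 ≠ M.reg 4 by lia))
    obtain ⟨M', hM', hsize, harr, hout⟩ := ih (M := (M.assignAll emitVertex).assignAll nextTarget)
      (S := insert (M.reg 2) S) (R := R \ {M.target (M.reg 3)})
      (show M.reg 4 = M.reg 3 + 1 + k by lia) (bijOn_update_Iio hS hxS)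
      (hIco ▸ hR.sdiff_singleton hs)
      (show M.target (M.reg 3) ∉ insert (M.reg 2) S by grind) (fun h => h.2 rfl) (by grind)
    refine ⟨M', ?_, hsize, harr.trans fun a ha => Function.update_of_ne ha _ _, ?_⟩
    · convert hstep.trans hM' using 1
      ring
    · rwa [hunion]

/-! ### Deletion from the arrays -/

section VertexArray

/-- The arrays `vert` and `pos` of `M` list exactly the vertices whose names form the set `S`. -/
structure StoresVertices (M : Memory) (S : Set ℕ) : Prop where
  image_vert : M.vert '' Set.Iio M.size = S
  leftInvOn_pos : Set.LeftInvOn M.pos M.vert (Set.Iio M.size)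

namespace StoresVertices

variable {M M' : Memory} {S : Set ℕ} {x : ℕ}

theorem congr (h : StoresVertices M S) (hsize : M'.size = M.size)
    (harr : Set.EqOn M'.arr M.arr {0, 1}) : StoresVertices M' S := by
  have hvert : M'.vert = M.vert := harr (by simp)
  have hpos : M'.pos = M.pos := harr (by simp)
  exact ⟨by rw [hvert, hsize, h.image_vert], by rw [hvert, hpos, hsize]; exact h.leftInvOn_pos⟩

theorem injOn_vert (h : StoresVertices M S) : Set.InjOn M.vert (Set.Iio M.size) :=
  h.leftInvOn_pos.injOn

theorem pos_lt (h : StoresVertices M S) (hx : x ∈ S) : M.pos x < M.size := by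
  obtain ⟨i, hi, rfl⟩ := h.image_vert ▸ hx
  exact (h.leftInvOn_pos hi).symm ▸ hi

theorem vert_pos (h : StoresVertices M S) (hx : x ∈ S) : M.vert (M.pos x) = x := by
  obtain ⟨i, hi, rfl⟩ := h.image_vert ▸ hx
  exact congrArg M.vert (h.leftInvOn_pos hi)

theorem size_eq_ncard (h : StoresVertices M S) : M.size = S.ncard := by
  rw [← h.image_vert, h.injOn_vert.ncard_image, Set.ncard_Iio_nat]

theorem deleteVertex (h : StoresVertices M S) (hx : M.reg 2 ∈ S) :
    StoresVertices (M.assignAll deleteVertex) (S \ {M.reg 2}) := by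
  have hp := h.pos_lt hx
  have hvp := h.vert_pos hx
  have hinj := h.injOn_vert
  have hlast : M.size - 1 < M.size := by lia
  constructor
  · change Function.update M.vert (M.pos (M.reg 2)) (M.vert (M.size - 1)) ''
      Set.Iio (M.size - 1) = S \ {M.reg 2}
    rw [← h.image_vert]
    ext z
    constructor
    · rintro ⟨i, hi : i < M.size - 1, rfl⟩
      rcases eq_or_ne i (M.pos (M.reg 2)) with rfl | hip
      · rw [Function.update_self]
        refine ⟨⟨_, hlast, rfl⟩, fun hz => ?_⟩
        exact hi.ne' (hinj hlast hp (hz.trans hvp.symm))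
      · rw [Function.update_of_ne hip]
        have hi' : i < M.size := by lia
        exact ⟨⟨i, hi', rfl⟩, fun hz => hip (hinj hi' hp (hz.trans hvp.symm))⟩
    · rintro ⟨⟨i, hi : i < M.size, rfl⟩, hix⟩
      have hip : i ≠ M.pos (M.reg 2) := fun hip => hix (hip ▸ hvp)
      rcases eq_or_ne i (M.size - 1) with rfl | hil
      · exact ⟨M.pos (M.reg 2), Set.mem_Iio.mpr (by lia), Function.update_self ..⟩
      · exact ⟨i, Set.mem_Iio.mpr (by lia), Function.update_of_ne hip ..⟩
  · change Set.LeftInvOn (Function.update M.pos (M.vert (M.size - 1)) (M.pos (M.reg 2)))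
      (Function.update M.vert (M.pos (M.reg 2)) (M.vert (M.size - 1))) (Set.Iio (M.size - 1))
    intro i (hi : i < M.size - 1)
    have hi' : i < M.size := by lia
    rcases eq_or_ne i (M.pos (M.reg 2)) with rfl | hip
    · rw [Function.update_self, Function.update_self]
    · rw [Function.update_of_ne hip, Function.update_of_ne fun hz => hi.ne (hinj hi' hlast hz)]
      exact h.leftInvOn_pos hi'

end StoresVertices

end VertexArray

section SlotMaps

variable {V : Type*} {name : V → ℕ} {H : SimpleGraph V} {T X : ℕ → ℕ} {e : V → V → ℕ}

/-- `e v w` is the slot of the edge `vw` at `v`, for the targets `T` and the cross pointers `X`. -/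
structure IsSlotMap (name : V → ℕ) (H : SimpleGraph V) (T X : ℕ → ℕ) (e : V → V → ℕ) : Prop where
  target_eq : ∀ {v w}, H.Adj v w → T (e v w) = name w
  cross_eq : ∀ {v w}, H.Adj v w → X (e v w) = e w v

namespace IsSlotMap

/-- The vertex whose slot it is can be read off as the target of the cross pointer. -/
theorem eq_and_eq_of_slot_eq (h : IsSlotMap name H T X e) (hn : Function.Injective name)
    {v w v' w' : V} (hvw : H.Adj v w) (hvw' : H.Adj v' w') (heq : e v w = e v' w') :
    v = v' ∧ w = w' := by
  constructor <;> apply hn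
  · rw [← h.target_eq hvw.symm, ← h.target_eq hvw'.symm, ← h.cross_eq hvw, ← h.cross_eq hvw', heq]
  · rw [← h.target_eq hvw, ← h.target_eq hvw', heq]

theorem injOn (h : IsSlotMap name H T X e) (hn : Function.Injective name) (v : V) :
    Set.InjOn (e v) (H.neighborSet v) :=
  fun _ hw _ hw' heq => (h.eq_and_eq_of_slot_eq hn hw hw' heq).2

variable [DecidableEq V]

/- The entry for the edge `wy` is moved into the gap left by `vw`; the case `y = v`, in which there
is nothing to move, is included. -/
theorem deleteEdges (h : IsSlotMap name H T X e) (hn : Function.Injective name) {v w y : V}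
    (hvw : H.Adj v w) (hwy : H.Adj w y) :
    IsSlotMap name (H.deleteEdges {s(v, w)}) (Function.update T (e w v) (T (e w y)))
      (Function.update (Function.update X (e w v) (e y w)) (e y w) (e w v))
      (fun a b => if a = w ∧ b = y then e w v else e a b) := by
  have hne {a b : V} (hab : (H.deleteEdges {s(v, w)}).Adj a b) : e a b ≠ e w v := fun heq => by
    obtain ⟨hab, hmem⟩ := SimpleGraph.deleteEdges_adj.mp hab
    obtain ⟨rfl, rfl⟩ := h.eq_and_eq_of_slot_eq hn hab hvw.symm heq
    exact hmem Sym2.eq_swap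
  constructor <;> intro a b hab <;> have hab' := (SimpleGraph.deleteEdges_adj.mp hab).1
  · split_ifs with hwy'
    · rw [Function.update_self, hwy'.2, h.target_eq hwy]
    · rw [Function.update_of_ne (hne hab), h.target_eq hab']
  · by_cases hyw : a = y ∧ b = w
    · obtain ⟨rfl, rfl⟩ := hyw
      rw [if_neg fun h => hwy.ne h.1.symm, if_pos ⟨rfl, rfl⟩, Function.update_self]
    by_cases hwy' : a = w ∧ b = y
    · obtain ⟨rfl, rfl⟩ := hwy'
      rw [if_pos ⟨rfl, rfl⟩, if_neg fun h => hyw h.symm, Function.update_of_ne,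
        Function.update_self]
      exact (hne hab.symm).symm
    · rw [if_neg hwy', if_neg fun h => hyw h.symm, Function.update_of_ne, Function.update_of_ne,
        h.cross_eq hab']
      · exact hne hab
      · exact fun heq => hyw (h.eq_and_eq_of_slot_eq hn hab' hwy.symm heq)

theorem image_slots (h : IsSlotMap name H T X e) (hn : Function.Injective name) {v w y : V}
    (hvw : H.Adj v w) (hwy : H.Adj w y) :
    (fun b => if b = y then e w v else e w b) '' (H.neighborSet w \ {v}) =
      e w '' H.neighborSet w \ {e w y} := by
  have hinj {b c : V} (hb : H.Adj w b) (hc : H.Adj w c) (heq : e w b = e w c) : b = c :=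
    h.injOn hn w hb hc heq
  ext s
  constructor
  · rintro ⟨b, ⟨hb, hbv : b ≠ v⟩, rfl⟩
    dsimp only
    split_ifs with hby
    · exact ⟨⟨v, hvw.symm, rfl⟩, fun heq => hbv (hby.trans (hinj hvw.symm hwy heq).symm)⟩
    · exact ⟨⟨b, hb, rfl⟩, fun heq => hby (hinj hb hwy heq)⟩
  · rintro ⟨⟨b, hb, rfl⟩, hby⟩
    have hby : b ≠ y := fun h => hby (h ▸ rfl)
    rcases eq_or_ne b v with rfl | hbv
    · exact ⟨y, ⟨hwy, hby.symm⟩, if_pos rfl⟩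
    · exact ⟨b, ⟨hb, hbv⟩, if_neg hby⟩

end IsSlotMap

end SlotMaps

section AdjacencyArrays

theorem neighborSet_deleteEdges_left {V : Type*} (H : SimpleGraph V) (v w : V) :
    (H.deleteEdges {s(v, w)}).neighborSet v = H.neighborSet v \ {w} := by
  ext b
  simp only [SimpleGraph.mem_neighborSet, SimpleGraph.deleteEdges_adj, Set.mem_sdiff,
    Set.mem_singleton_iff, Sym2.congr_right]

theorem neighborSet_deleteEdges_right {V : Type*} (H : SimpleGraph V) (v w : V) :
    (H.deleteEdges {s(v, w)}).neighborSet w = H.neighborSet w \ {v} := by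
  rw [Sym2.eq_swap, neighborSet_deleteEdges_left]

theorem neighborSet_deleteEdges_of_ne {V : Type*} (H : SimpleGraph V) {q v w : V} (hv : q ≠ v)
    (hw : q ≠ w) : (H.deleteEdges {s(v, w)}).neighborSet q = H.neighborSet q := by
  ext b
  simp [SimpleGraph.mem_neighborSet, hv, hw]

theorem Ico_sub_one_right_eq_sdiff (m n : ℕ) : Set.Ico m (n - 1) = Set.Ico m n \ {n - 1} := by
  ext i
  simp only [Set.mem_Ico, Set.mem_sdiff, Set.mem_singleton_iff]
  lia

variable {V : Type*} {name : V → ℕ} {H : SimpleGraph V} {M M' : Memory} {e : V → V → ℕ}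

/-- The adjacency arrays with cross pointers in `M` store `H`, with `e v w` as the slot of the edge
`vw` at `v`; unlike in `Stores`, the vertex set is not recorded. -/
structure StoresEdges (M : Memory) (name : V → ℕ) (H : SimpleGraph V) (e : V → V → ℕ) : Prop
    extends IsSlotMap name H M.target M.cross e where
  first_le_last : ∀ v, M.first (name v) ≤ M.last (name v)
  slots_eq : ∀ v, M.slots (name v) = e v '' H.neighborSet v

namespace StoresEdges

theorem congr (h : StoresEdges M name H e) (harr : Set.EqOn M'.arr M.arr {2, 3, 4, 5}) :
    StoresEdges M' name H e := by
  have hfirst : M'.first = M.first := harr (by simp)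
  have hlast : M'.last = M.last := harr (by simp)
  have htarget : M'.target = M.target := harr (by simp)
  have hcross : M'.cross = M.cross := harr (by simp)
  refine ⟨by rw [htarget, hcross]; exact h.toIsSlotMap, fun v => ?_, fun v => ?_⟩
  · rw [hfirst, hlast]
    exact h.first_le_last v
  · rw [Memory.slots, hfirst, hlast]
    exact h.slots_eq v

theorem bijOn_target (h : StoresEdges M name H e) (hn : Function.Injective name) (v : V) :
    Set.BijOn M.target (M.slots (name v)) (name '' H.neighborSet v) := by
  rw [h.slots_eq]
  refine ⟨?_, ?_, ?_⟩
  · rintro _ ⟨w, hw, rfl⟩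
    exact ⟨w, hw, (h.target_eq hw).symm⟩
  · rintro _ ⟨w, hw, rfl⟩ _ ⟨w', hw', rfl⟩ heq
    rw [h.target_eq hw, h.target_eq hw'] at heq
    rw [hn heq]
  · rintro _ ⟨w, hw, rfl⟩
    exact ⟨_, ⟨w, hw, rfl⟩, h.target_eq hw⟩

theorem last_eq (h : StoresEdges M name H e) (hn : Function.Injective name) (v : V) :
    M.last (name v) = M.first (name v) + (H.neighborSet v).ncard := by
  have hcard := (h.bijOn_target hn v).ncard_eq
  rw [Set.ncard_image_of_injective _ hn, Memory.slots, Set.ncard_Ico_nat] at hcard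
  have := h.first_le_last v
  lia

theorem first_lt_last (h : StoresEdges M name H e) {v w : V} (hvw : H.Adj v w) :
    M.first (name v) < M.last (name v) := by
  have hmem : e v w ∈ M.slots (name v) := h.slots_eq v ▸ ⟨w, hvw, rfl⟩
  exact hmem.1.trans_lt hmem.2

theorem exists_slot_eq_last_sub_one (h : StoresEdges M name H e) {v : V}
    (hlt : M.first (name v) < M.last (name v)) :
    ∃ w, H.Adj v w ∧ e v w = M.last (name v) - 1 := by
  change M.last (name v) - 1 ∈ e v '' H.neighborSet v
  rw [← h.slots_eq, Memory.slots, Set.mem_Ico]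
  lia

theorem deleteEdges [DecidableEq V] (h : StoresEdges M name H e) (hn : Function.Injective name)
    {v w y : V} (hvw : H.Adj v w) (hwy : H.Adj w y) (hs : e v w = M.last (name v) - 1)
    (hl : e w y = M.last (name w) - 1) (hfirst : M'.first = M.first)
    (hlast : M'.last = Function.update
      (Function.update M.last (name w) (M.last (name w) - 1)) (name v) (M.last (name v) - 1))
    (htarget : M'.target = Function.update M.target (e w v) (M.target (e w y)))
    (hcross : M'.cross = Function.update
      (Function.update M.cross (e w v) (M.cross (e w y))) (M.cross (e w y)) (M.cross (e v w))) :
    StoresEdges M' name (H.deleteEdges {s(v, w)})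
      (fun a b => if a = w ∧ b = y then e w v else e a b) := by
  have hltv := h.first_lt_last hvw
  have hltw := h.first_lt_last hvw.symm
  refine ⟨?_, fun q => ?_, fun q => ?_⟩
  · rw [htarget, hcross, h.cross_eq hvw, h.cross_eq hwy]
    exact h.toIsSlotMap.deleteEdges hn hvw hwy
  · rw [hlast, hfirst]
    rcases eq_or_ne q v with rfl | hqv
    · rw [Function.update_self]
      lia
    rw [Function.update_of_ne (hn.ne hqv)]
    rcases eq_or_ne q w with rfl | hqw
    · rw [Function.update_self]
      lia
    · rw [Function.update_of_ne (hn.ne hqw)]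
      exact h.first_le_last q
  · rw [Memory.slots, hlast, hfirst]
    rcases eq_or_ne q v with rfl | hqv
    · rw [Function.update_self, Ico_sub_one_right_eq_sdiff, neighborSet_deleteEdges_left]
      simp only [hvw.ne, false_and, if_false]
      rw [← Memory.slots, h.slots_eq, ← hs,
        (h.injOn hn q).image_sdiff_subset (Set.singleton_subset_iff.mpr hvw), Set.image_singleton]
    rw [Function.update_of_ne (hn.ne hqv)]
    rcases eq_or_ne q w with rfl | hqw
    · rw [Function.update_self, Ico_sub_one_right_eq_sdiff, neighborSet_deleteEdges_right]
      simp only [true_and]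
      rw [h.image_slots hn hvw hwy, ← Memory.slots, h.slots_eq, ← hl]
    · rw [Function.update_of_ne (hn.ne hqw), neighborSet_deleteEdges_of_ne H hqv hqw]
      simp only [hqw, false_and, if_false]
      exact h.slots_eq q

theorem deleteLastEdge (h : StoresEdges M name H e) (hn : Function.Injective name) {v : V}
    (hv : M.reg 2 = name v) (hlast : M.reg 4 = M.last (name v))
    (hlt : M.first (name v) < M.last (name v)) :
    ∃ w e', H.Adj v w ∧
      StoresEdges (M.assignAll deleteLastEdge) name (H.deleteEdges {s(v, w)}) e' := by
  classical
  obtain ⟨w, hvw, hs⟩ := h.exists_slot_eq_last_sub_one hlt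
  obtain ⟨y, hwy, hl⟩ := h.exists_slot_eq_last_sub_one (h.first_lt_last hvw.symm)
  have hslot : M.reg 4 - 1 = e v w := by rw [hlast, hs]
  have htarget : M.target (M.reg 4 - 1) = name w := by rw [hslot, h.target_eq hvw]
  have hcross : M.cross (M.reg 4 - 1) = e w v := by rw [hslot, h.cross_eq hvw]
  refine ⟨w, _, hvw, h.deleteEdges hn hvw hwy hs hl rfl ?_ ?_ ?_⟩
  · rw [← htarget, ← hlast, ← hv]
    rfl
  · rw [← hcross, hl, ← htarget]
    rfl
  · rw [← hcross, hl, ← htarget, ← hslot]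
    rfl

end StoresEdges

end AdjacencyArrays

section Removal

variable {V : Type*} {name : V → ℕ} {G H : SimpleGraph V} {M : Memory} {e : V → V → ℕ}

theorem deleteIncidenceSet_deleteEdges (H : SimpleGraph V) (v w : V) :
    (H.deleteEdges {s(v, w)}).deleteIncidenceSet v = H.deleteIncidenceSet v := by
  ext a b
  simp only [SimpleGraph.deleteIncidenceSet_adj, SimpleGraph.deleteEdges_adj,
    Set.mem_singleton_iff, Sym2.eq_iff]
  tauto

theorem exists_reaches_deleteIncidenceSet (hn : Function.Injective name) (k : ℕ)
    (h : StoresEdges M name H e) {v : V} (hv : M.reg 2 = name v)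
    (hfirst : M.reg 3 = M.first (name v)) (hlast : M.reg 4 = M.last (name v))
    (hk : (H.neighborSet v).ncard = k) :
    ∃ M' e', Reaches pivotProgram 18 M (14 * k + 1) 32 M' ∧
      StoresEdges M' name (H.deleteIncidenceSet v) e' ∧
      Set.EqOn M'.reg M.reg {0, 1, 2, 5, 6} ∧ Set.EqOn M'.arr M.arr {0, 1, 6} := by
  induction k generalizing M H e with
  | zero =>
    have hisol : H.deleteIncidenceSet v = H := by
      have hfin : (H.neighborSet v).Finite :=
        .of_finite_image (h.slots_eq v ▸ Set.finite_Ico _ _) (h.injOn hn v)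
      have hempty : H.neighborSet v = ∅ := (Set.ncard_eq_zero hfin).mp hk
      have hnadj (a : V) : ¬ H.Adj v a := Set.eq_empty_iff_forall_notMem.mp hempty a
      ext a b
      rw [SimpleGraph.deleteIncidenceSet_adj, and_iff_left_iff_imp]
      exact fun hab => ⟨fun h => hnadj b (h ▸ hab), fun h => hnadj a (h ▸ hab.symm)⟩
    have heq : M.reg 3 = M.reg 4 := by rw [hfirst, hlast, h.last_eq hn, hk, Nat.add_zero]
    exact ⟨M, e, reaches_jumpEq_of_eq rfl heq, hisol.symm ▸ h, Set.eqOn_refl _ _,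
      Set.eqOn_refl _ _⟩
  | succ k ih =>
    have hlt : M.first (name v) < M.last (name v) := by
      rw [h.last_eq hn, hk]
      lia
    obtain ⟨w, e₁, hvw, h₁⟩ := h.deleteLastEdge hn hv hlast hlt
    have hlast₁ : (M.assignAll deleteLastEdge).reg 4 =
        (M.assignAll deleteLastEdge).last (name v) := by
      rw [← hv]
      exact (Function.update_self (β := fun _ => ℕ) (M.reg 2) (M.reg 4 - 1) _).symm
    obtain ⟨M', e', hM', hE, hreg, harr⟩ := ih (M := M.assignAll deleteLastEdge) h₁ hv hfirst
      hlast₁ (by rw [neighborSet_deleteEdges_left,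
        Set.ncard_sdiff_singleton_of_mem (show w ∈ H.neighborSet v from hvw), hk,
        Nat.add_sub_cancel])
    refine ⟨M', e', ?_, deleteIncidenceSet_deleteEdges H v w ▸ hE, hreg.trans ?_, harr.trans ?_⟩
    · convert (reaches_deleteLastEdge (by rw [hfirst, hlast]; exact hlt.ne)).trans hM' using 1
      ring
    · rintro r (rfl | rfl | rfl | rfl | rfl) <;> rfl
    · rintro a (rfl | rfl | rfl) <;> rfl

theorem exists_reaches_removeVertex (hn : Function.Injective name) {S : Set ℕ}
    (hE : StoresEdges M name H e) (hS : StoresVertices M S) {b : V} (hbS : name b ∈ S)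
    (h56 : M.reg 5 ≠ M.reg 6) (hb : M.out (M.reg 5 - 1) = name b) :
    ∃ M' e', Reaches pivotProgram 13 M (14 * (H.neighborSet b).ncard + 12) 13 M' ∧
      StoresEdges M' name (H.deleteIncidenceSet b) e' ∧ StoresVertices M' (S \ {name b}) ∧
      M'.reg 5 = M.reg 5 - 1 ∧ M'.reg 6 = M.reg 6 ∧ M'.outSize = M.outSize ∧
      M'.out = M.out := by
  obtain ⟨M₁, e₁, hM₁, hE₁, hreg, harr⟩ := exists_reaches_deleteIncidenceSet hn _
    (M := M.assignAll popOutput) (hE.congr fun _ _ => rfl) hb (congrArg M.first hb)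
    (congrArg M.last hb) rfl
  have hreg2 : M₁.reg 2 = name b := (hreg (by simp)).trans hb
  have hS₁ : StoresVertices M₁ S := hS.congr (hreg (show 0 ∈ _ by simp)) (harr.mono (by simp))
  refine ⟨M₁.assignAll deleteVertex, e₁, ?_, hE₁.congr ?_, ?_, hreg (by simp), hreg (by simp),
    hreg (show 1 ∈ _ by simp), harr (show 6 ∈ _ by simp)⟩
  · convert ((reaches_popOutput h56).trans hM₁).trans (reaches_deleteVertex M₁) using 1
    ring
  · rintro a (rfl | rfl | rfl | rfl) <;> rfl
  · rw [← hreg2]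
    exact hS₁.deleteVertex (hreg2 ▸ hbS)

/-- The graph left over from `H` when the vertices in `B` lose all their edges; unlike `remaining`,
it keeps the whole vertex set. -/
def isolate (H : SimpleGraph V) (B : Finset V) : SimpleGraph V :=
  H.deleteEdges {d | ∃ b ∈ d, b ∈ B}

theorem isolate_adj {B : Finset V} {a b : V} :
    (isolate H B).Adj a b ↔ H.Adj a b ∧ a ∉ B ∧ b ∉ B := by
  simp [isolate]

variable [DecidableEq V]

theorem isolate_deleteIncidenceSet_erase {B : Finset V} {b : V} (hb : b ∈ B) :
    isolate (H.deleteIncidenceSet b) (B.erase b) = isolate H B := by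
  ext x y
  simp only [isolate_adj, SimpleGraph.deleteIncidenceSet_adj, Finset.mem_erase]
  grind

variable [Fintype V]

theorem ncard_neighborSet_lt_deg (h : H ≤ G) (v : V) : (H.neighborSet v).ncard < deg G v := by
  rw [deg, ← Set.ncard_coe_finset]
  refine Set.ncard_lt_ncard (Set.ssubset_iff_of_subset ?_ |>.mpr ⟨v, ?_, H.irrefl⟩)
  · exact fun w hw => mem_nbhd.mpr (Or.inr (h hw))
  · exact mem_nbhd.mpr (Or.inl rfl)

theorem exists_reaches_removal (hn : Function.Injective name) (i : ℕ) {B : Finset V} {S : Set ℕ}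
    (hHG : H ≤ G) (hE : StoresEdges M name H e) (hS : StoresVertices M S) (hBS : name '' B ⊆ S)
    (hB : Set.BijOn M.out (Set.Iio i) (name '' B)) (hi : M.reg 5 = i) (h0 : M.reg 6 = 0) :
    ∃ n ≤ 14 * ∑ v ∈ B, deg G v + 1, ∃ M' e', Reaches pivotProgram 13 M n 38 M' ∧
      StoresEdges M' name (isolate H B) e' ∧ StoresVertices M' (S \ name '' B) ∧
      M'.outSize = M.outSize ∧ M'.out = M.out := by
  induction i generalizing M H e B S with
  | zero =>
    obtain rfl : B = ∅ := by simpa using hB.image_eq.symm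
    refine ⟨1, by simp, M, e, reaches_jumpEq_of_eq rfl (hi.trans h0.symm), ?_, by simpa, rfl, rfl⟩
    simpa [isolate] using hE
  | succ i ih =>
    obtain ⟨b, hb, hbi⟩ := hB.mapsTo (Set.mem_Iio.mpr i.lt_succ_self)
    have hpop : M.out (M.reg 5 - 1) = name b := by rw [hi, Nat.add_sub_cancel, hbi]
    obtain ⟨M₁, e₁, hM₁, hE₁, hS₁, hreg5, hreg6, hsize, hout⟩ := exists_reaches_removeVertex hn
      hE hS (hBS ⟨b, hb, rfl⟩) (by lia) hpop
    have herase : name '' (B.erase b) = name '' B \ {name b} := by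
      rw [Finset.coe_erase, Set.image_sdiff hn, Set.image_singleton]
    have hB₁ : Set.BijOn M₁.out (Set.Iio i) (name '' (B.erase b)) := by
      have hIio : Set.Iio (i + 1) \ {i} = Set.Iio i :=
        (congrArg (· \ {i}) (Order.Iio_succ i)).trans Set.Iic_sdiff_right
      rw [hout, herase, hbi, ← hIio]
      exact hB.sdiff_singleton (Set.mem_Iio.mpr i.lt_succ_self)
    obtain ⟨n, hle, M', e', hM', hE', hS', hsize', hout'⟩ := ih
      ((H.deleteIncidenceSet_le b).trans hHG) hE₁ hS₁
      (herase ▸ Set.sdiff_subset_sdiff_left hBS) hB₁ (by rw [hreg5, hi, Nat.add_sub_cancel])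
      (hreg6.trans h0)
    refine ⟨_, ?_, M', e', hM₁.trans hM', isolate_deleteIncidenceSet_erase hb ▸ hE', ?_,
      hsize'.trans hsize, hout'.trans hout⟩
    · have hdeg := ncard_neighborSet_lt_deg hHG b
      rw [← Finset.add_sum_erase B _ hb]
      lia
    · rwa [herase, Set.sdiff_sdiff, Set.union_sdiff_self, Set.singleton_union,
        Set.insert_eq_of_mem (Set.mem_image_of_mem name hb)] at hS'

end Removal

section Stores

variable {V : Type*} {name : V → ℕ} {G : SimpleGraph V} {M : Memory} {e : V → V → ℕ}

theorem StoresEdges.remaining {B : Finset V} (h : StoresEdges M name (isolate G B) e) :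
    StoresEdges M (fun v : {v : V // v ∉ B} => name v) (remaining G B) (fun v w => e v w) := by
  have hadj {v w : {v : V // v ∉ B}} (hvw : (CorrClust.remaining G B).Adj v w) :
      (isolate G B).Adj v w := isolate_adj.mpr ⟨hvw, v.2, w.2⟩
  refine ⟨⟨fun hvw => h.target_eq (hadj hvw), fun hvw => h.cross_eq (hadj hvw)⟩,
    fun v => h.first_le_last v, fun v => (h.slots_eq v).trans ?_⟩
  ext s
  constructor
  · rintro ⟨w, hw, rfl⟩
    obtain ⟨hvw, -, hwB⟩ := isolate_adj.mp hw
    exact ⟨⟨w, hwB⟩, hvw, rfl⟩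
  · rintro ⟨w, hw, rfl⟩
    exact ⟨w, hadj hw, rfl⟩

variable [Fintype V]

theorem StoresEdges.stores (h : StoresEdges M name G e) (hn : Function.Injective name)
    (hS : StoresVertices M (Set.range name)) : Stores M name G where
  name_injective := hn
  size_eq := by rw [hS.size_eq_ncard, Set.ncard_range_of_injective hn, Nat.card_eq_fintype_card]
  vert_mem i hi := by
    obtain ⟨v, hv⟩ := hS.image_vert ▸ Set.mem_image_of_mem M.vert (Set.mem_Iio.mpr hi)
    exact ⟨v, hv.symm⟩
  pos_spec v := ⟨hS.pos_lt ⟨v, rfl⟩, hS.vert_pos ⟨v, rfl⟩⟩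
  first_le_last := h.first_le_last
  disjoint v w hvw := by
    rw [h.slots_eq, h.slots_eq, Set.disjoint_left]
    rintro _ ⟨a, ha, rfl⟩ ⟨b, hb, heq⟩
    exact hvw (h.eq_and_eq_of_slot_eq hn hb ha heq).1.symm
  target_injOn v := (h.bijOn_target hn v).injOn
  target_image v := (h.bijOn_target hn v).image_eq
  cross_spec v w s hs hsw := by
    obtain ⟨w', hvw' : G.Adj v w', rfl⟩ := h.slots_eq v ▸ hs
    obtain rfl : w' = w := hn ((h.target_eq hvw').symm.trans hsw)
    rw [h.cross_eq hvw', h.target_eq hvw'.symm, h.slots_eq]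
    exact ⟨⟨v, hvw'.symm, rfl⟩, rfl⟩

theorem Stores.exists_storesEdges (h : Stores M name G) : ∃ e, StoresEdges M name G e := by
  have hslot (v w : V) : ∃ s, G.Adj v w → s ∈ M.slots (name v) ∧ M.target s = name w := by
    by_cases hvw : G.Adj v w
    · obtain ⟨s, hs⟩ : name w ∈ M.target '' M.slots (name v) := h.target_image v ▸ ⟨w, hvw, rfl⟩
      exact ⟨s, fun _ => hs⟩
    · exact ⟨0, fun hadj => absurd hadj hvw⟩
  choose e he using hslot
  refine ⟨e, ⟨fun hvw => (he _ _ hvw).2, fun {v w} hvw => ?_⟩, h.first_le_last, fun v => ?_⟩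
  · obtain ⟨hmem, htarget⟩ := h.cross_spec v w _ (he v w hvw).1 (he v w hvw).2
    obtain ⟨hmem', htarget'⟩ := he w v hvw.symm
    exact h.target_injOn w hmem hmem' (htarget.trans htarget'.symm)
  · ext s
    constructor
    · intro hs
      obtain ⟨w, hw, hws⟩ := h.target_image v ▸ Set.mem_image_of_mem M.target hs
      exact ⟨w, hw, h.target_injOn v (he v w hw).1 hs ((he v w hw).2.trans hws)⟩
    · rintro ⟨w, hw, rfl⟩
      exact (he v w hw).1

theorem Stores.storesVertices (h : Stores M name G) : StoresVertices M (Set.range name) := by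
  have himage : M.vert '' Set.Iio M.size = Set.range name := by
    ext x
    constructor
    · rintro ⟨i, hi, rfl⟩
      obtain ⟨v, hv⟩ := h.vert_mem i hi
      exact ⟨v, hv.symm⟩
    · rintro ⟨v, rfl⟩
      exact ⟨M.pos (name v), h.pos_spec v⟩
  have hinj : Set.InjOn M.vert (Set.Iio M.size) := by
    refine Set.injOn_of_ncard_image_eq ?_ (Set.finite_Iio _)
    rw [himage, Set.ncard_range_of_injective h.name_injective, Nat.card_eq_fintype_card,
      Set.ncard_Iio_nat, h.size_eq]
  refine ⟨himage, fun i hi => ?_⟩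
  obtain ⟨v, hv⟩ := h.vert_mem i hi
  rw [hv]
  exact hinj (h.pos_spec v).1 hi ((h.pos_spec v).2.trans hv.symm)

end Stores

theorem drawBelow_card_eq_map {V : Type*} [Fintype V] [Nonempty V] {f : V → ℕ}
    (hf : Function.Injective f) (hlt : ∀ v, f v < Fintype.card V) :
    drawBelow (Fintype.card V) = (PMF.uniformOfFintype V).map f := by
  classical
  have himage : Finset.univ.image f = Finset.range (Fintype.card V) := by
    refine Finset.eq_of_subset_of_card_le (fun x hx => ?_) ?_
    · obtain ⟨v, -, rfl⟩ := Finset.mem_image.mp hx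
      exact Finset.mem_range.mpr (hlt v)
    · rw [Finset.card_range, Finset.card_image_of_injective _ hf, Finset.card_univ]
  have hne : (Finset.range (Fintype.card V)).Nonempty :=
    Finset.nonempty_range_iff.mpr Fintype.card_ne_zero
  ext x
  rw [drawBelow, dif_pos hne, PMF.uniformOfFinset_apply, PMF.map_apply, tsum_fintype,
    Finset.card_range, ← himage]
  simp only [PMF.uniformOfFintype_apply]
  split_ifs with hx
  · obtain ⟨v, -, rfl⟩ := Finset.mem_image.mp hx
    simp only [hf.eq_iff, Finset.sum_ite_eq, Finset.mem_univ, if_true]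
  · refine (Finset.sum_eq_zero fun v _ => if_neg ?_).symm
    rintro rfl
    exact hx (Finset.mem_image_of_mem f (Finset.mem_univ v))

section Correctness

variable {V : Type*} [Fintype V] {name : V → ℕ} {G : SimpleGraph V} {M : Memory}

theorem outCluster_eq (hn : Function.Injective name) {B : Finset V}
    (h : M.out '' Set.Iio M.outSize = name '' B) : outCluster name M = B := by
  ext v
  rw [outCluster, Finset.mem_filter_univ, ← Finset.mem_coe, ← hn.mem_set_image, ← h]
  rfl

variable [DecidableEq V]

theorem coe_nbhd (G : SimpleGraph V) (u : V) : (nbhd G u : Set V) = insert u (G.neighborSet u) := by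
  ext v
  exact mem_nbhd

theorem exists_reaches_output {e : V → V → ℕ} (hn : Function.Injective name)
    (hE : StoresEdges M name G e) {u : V} (hu : M.vert (M.reg 2) = name u) :
    ∃ M', Reaches pivotProgram 1 M (6 * (G.neighborSet u).ncard + 7) 11 M' ∧ M'.size = M.size ∧
      Set.EqOn M'.arr M.arr {6}ᶜ ∧ Set.BijOn M'.out (Set.Iio M'.outSize) (name '' nbhd G u) := by
  have hreg2 : (M.assignAll openPivot).reg 2 = name u := hu
  have hreg3 : (M.assignAll openPivot).reg 3 = M.first (name u) := congrArg M.first hu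
  have hreg4 : (M.assignAll openPivot).reg 4 = M.last (name u) := congrArg M.last hu
  have htarget : Set.BijOn (M.assignAll openPivot).target
      (Set.Ico ((M.assignAll openPivot).reg 3) ((M.assignAll openPivot).reg 4))
      (name '' G.neighborSet u) := by
    rw [hreg3, hreg4]
    exact hE.bijOn_target hn u
  have hself : name u ∉ name '' G.neighborSet u := by
    rw [hn.mem_set_image]
    exact G.irrefl
  obtain ⟨M', hM', hsize, harr, hout⟩ := exists_reaches_emit (G.neighborSet u).ncard (S := ∅)
    (by rw [hreg3, hreg4, hE.last_eq hn]) (show Set.BijOn _ (Set.Iio 0) ∅ by simp) htarget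
    (Set.notMem_empty _) (hreg2 ▸ hself) (Set.empty_disjoint _)
  refine ⟨M', ?_, hsize, harr, ?_⟩
  · convert (reaches_openPivot M).trans hM' using 1
    ring
  · rwa [hreg2, Set.empty_union, ← Set.image_insert_eq, ← coe_nbhd] at hout

theorem exists_reaches_pivot (h : Stores M name G) (u : V) :
    ∃ n M', n + 1 ≤ 25 * ∑ v ∈ nbhd G u, deg G v ∧
      Reaches pivotProgram 1 (M.setReg 2 (M.pos (name u))) n 38 M' ∧
      outCluster name M' = nbhd G u ∧ (nbhd G u).card = M'.outSize ∧
      Stores M' (fun v : {v : V // v ∉ nbhd G u} => name v) (remaining G (nbhd G u)) := by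
  have hn := h.name_injective
  obtain ⟨e, hE⟩ := h.exists_storesEdges
  obtain ⟨M₁, hM₁, hsize₁, harr₁, hout₁⟩ := exists_reaches_output hn
    (M := M.setReg 2 (M.pos (name u))) (hE.congr fun _ _ => rfl) (h.pos_spec u).2
  have hE₁ : StoresEdges (M₁.assignAll startRemoval) name G e :=
    hE.congr (harr₁.mono (by simp [Set.subset_def]))
  have hS₁ : StoresVertices (M₁.assignAll startRemoval) (Set.range name) :=
    h.storesVertices.congr hsize₁ (harr₁.mono (by simp [Set.subset_def]))
  obtain ⟨n, hle, M', e', hM', hE', hS', hsize', hout'⟩ := exists_reaches_removal hn M₁.outSize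
    le_rfl hE₁ hS₁ (Set.image_subset_range _ _) hout₁ rfl rfl
  have hbij : Set.BijOn M'.out (Set.Iio M'.outSize) (name '' nbhd G u) := by
    rw [hout', hsize']
    exact hout₁
  refine ⟨_, M', ?_, (hM₁.trans (reaches_startRemoval M₁)).trans hM',
    outCluster_eq hn hbij.image_eq, ?_, hE'.remaining.stores (hn.comp Subtype.val_injective) ?_⟩
  · have hdeg := ncard_neighborSet_lt_deg le_rfl u (G := G)
    have hsum := Finset.single_le_sum (f := deg G) (fun _ _ => Nat.zero_le _)
      (mem_nbhd (G := G).mpr (Or.inl (Eq.refl u)))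
    lia
  · rw [← Set.ncard_coe_finset, ← Set.ncard_image_of_injective _ hn, ← hbij.ncard_eq,
      Set.ncard_Iio_nat]
  · have hrange : Set.range (fun v : {v // v ∉ nbhd G u} => name v) = name '' (nbhd G u)ᶜ :=
      (Set.range_comp name Subtype.val).trans (congrArg _ Subtype.range_coe)
    rwa [hrange, ← Set.range_sdiff_image hn]

theorem performsPivotStep [Nonempty V] (G : SimpleGraph V) :
    PerformsPivotStep pivotProgram 25 G := by
  intro name M h
  choose n F hn hF hcluster hcard hstores using exists_reaches_pivot h
  have hstep : step pivotProgram ⟨M, 0, 0⟩ = (PMF.uniformOfFintype V).map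
      fun u => (⟨M.setReg 2 (M.pos (name u)), 1, 1⟩ : Config) := by
    have hpos : Function.Injective fun v => M.pos (name v) := fun v w hvw => by
      apply h.name_injective
      rw [← (h.pos_spec v).2, ← (h.pos_spec w).2]
      exact congrArg M.vert hvw
    change (drawBelow M.size).map _ = _
    rw [h.size_eq, drawBelow_card_eq_map hpos fun v => h.size_eq ▸ (h.pos_spec v).1, PMF.map_comp]
    rfl
  have hrun : run pivotProgram M (∑ u, n u + 1) =
      (PMF.uniformOfFintype V).map fun u => (⟨F u, 38, 1 + n u⟩ : Config) := by
    rw [run_eq_runFrom, runFrom, hstep, PMF.bind_map, ← PMF.bind_pure_comp]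
    refine congrArg _ (funext fun u => ?_)
    obtain ⟨m, hm⟩ := Nat.exists_eq_add_of_le
      (Finset.single_le_sum (fun v _ => Nat.zero_le (n v)) (Finset.mem_univ u))
    rw [Function.comp_apply, Function.comp_apply, hm, runFrom_add, hF u 1, PMF.pure_bind]
    have hhalted : Halted pivotProgram ⟨F u, 38, 1 + n u⟩ := le_refl 38
    exact runFrom_of_halted hhalted m
  refine ⟨∑ u, n u + 1, ?_, fun c hc => ?_⟩
  · rw [hrun, PMF.map_comp, pivotStep]
    exact congrArg (PMF.map · _) (funext hcluster)
  · rw [hrun, PMF.support_map] at hc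
    obtain ⟨u, -, rfl⟩ := hc
    dsimp only
    rw [hcluster u]
    exact ⟨le_refl 38, hcard u, (add_comm _ _).trans_le (hn u), hstores u⟩

end Correctness

end CorrClust

theorem mainTheorem2_general :
    ∃ (prog : CorrClust.Program) (K : ℕ),
      ∀ (V : Type*) [Fintype V] [DecidableEq V] [Nonempty V] (G : SimpleGraph V),
        CorrClust.PerformsPivotStep prog K G ∧
        ∀ (η : ℝ) (P : CorrClust.Clustering V), 0 ≤ η → CorrClust.IsOptimal G P →
          (∀ C ∈ P.parts, ¬ CorrClust.GoodOnAverage G η C) →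
          CorrClust.expect (CorrClust.pivotStep G) (fun C => (CorrClust.stepCost G C : ℝ)) ≤
            (3 - η / (2 / 3 * η + 1)) *
              CorrClust.expect (CorrClust.pivotStep G) (CorrClust.optDecrease G) :=
  ⟨CorrClust.pivotProgram, 25, fun _ _ _ _ G => ⟨CorrClust.performsPivotStep G,
    fun _ _ hη hopt hP => CorrClust.expect_stepCost_le hη hopt hP⟩⟩

theorem mainTheorem2 :
    ∃ (prog : CorrClust.Program) (K : ℕ),
      ∀ (V : Type*) [Fintype V] [DecidableEq V] [Nonempty V] (G : SimpleGraph V),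
        CorrClust.PerformsPivotStep prog K G ∧
        ∀ (ε : ℝ) (P : CorrClust.Clustering V), CorrClust.IsOptimal G P →
          (∀ C ∈ P.parts, ¬ CorrClust.GoodOnAverage G (ε ^ 2) C) →
          CorrClust.expect (CorrClust.pivotStep G) (fun C => (CorrClust.stepCost G C : ℝ)) ≤
            (3 - ε ^ 2 / (5 / 6 * ε ^ 2 + 1)) *
              CorrClust.expect (CorrClust.pivotStep G) (CorrClust.optDecrease G) := by
  obtain ⟨prog, K, h⟩ := mainTheorem2_general
  refine ⟨prog, K, fun V _ _ _ G => ⟨(h V G).1, fun ε P hopt hP => ?_⟩⟩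
  exact CorrClust.le_five_sixths_of_le_two_thirds (sq_nonneg ε)
    (CorrClust.expect_nonneg _ fun _ => Nat.cast_nonneg _) ((h V G).2 _ P (sq_nonneg ε) hopt hP)
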